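/- Let $k$ be a commutative ring and let $R,S$ be (associative, unital, not necessarily commutative) $k$-algebras. Write $\mathrm{Mod}\text{-}R$ for the category of right $R$-modules. Assume $\operatorname{w.gl.dim} R\le 1$, i.e. $\operatorname{Tor}_2^R(M,N)=0$ for all right $R$-modules $M$ and left $R$-modules $N$. Let $f\colon R\to S$ be a homological epimorphism, i.e. an epimorphism in the category of $k$-algebras with $\operatorname{Tor}_i^R(S,S)=0$ for all $i\ge 1$. Regard $\mathrm{Mod}\text{-}S$ as a class of right $R$-modules via restriction along $f$ (closed under isomorphism), and put $$\mathcal X_0=\{X'\in \mathrm{Mod}\text{-}R \mid X'\otimes_R S=0=\operatorname{Tor}_1^R(X',S)\}.$$ For a class $\mathcal C$ of right $R$-modules, a $\mathcal C$-reflection of $M$ is a map $M\to C$ with $C\in\mathcal C$ through which every map from $M$ to a member of $\mathcal C$ factors uniquely; a $\mathcal C$-coreflection is defined dually. (1) There are functors $M\mapsto X_M$ and $M\mapsto X^M$ from $\mathrm{Mod}\text{-}R$ to itself, and a five-term exact sequence of right $R$-modules, natural in $M\in\mathrm{Mod}\text{-}R$, $$\varepsilon_M\colon\quad 0\to \operatorname{Tor}_1^R(M,S)\to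 X_M\to M\to M\otimes_R S\to X^M\to 0,$$ in which $M\to M\otimes_R S$ is the canonical map $m\mapsto m\otimes 1$, such that for every $M$: the map $X_M\to M$ is an $\mathcal X_0$-coreflection, the map $M\to M\otimes_R S$ is a $(\mathrm{Mod}\text{-}S)$-reflection, and $X^M\in\mathcal X_0$. The functor $M\mapsto\varepsilon_M$ commutes with direct limits (filtered colimits). (2) Consider exact sequences $E\colon 0\to E_0\to E_1\to E_2\to E_3\to E_4\to 0$ of right $R$-modules. If $E_0,E_3\in\mathrm{Mod}\text{-}S$ and $E_1,E_4\in\mathcal X_0$, then $E_1\to E_2$ is an $\mathcal X_0$-coreflection and $E_2\to E_3$ is a $(\mathrm{Mod}\text{-}S)$-reflection. (3) If $E$ and $E'$ are exact sequences as in (2) in which $E_1\to E_2$, $E_1'\to E_2'$ are $\mathcal X_0$-coreflections and $E_2\to E_3$, $E_2'\to E_3'$ are $(\mathrm{Mod}\text{-}S)$-reflections, then every homomorphism $E_2\to E_2'$ extends to a unique morphism of sequences $E\to E'$, and every isomorphism $E_2\cong E_2'$ extends to a unique isomorphism of sequences $E\cong E'$. In particular $\varepsilon_M$ is unique up to a unique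 isomorphism and functorial in $M$. -/

import Mathlib

open CategoryTheory CategoryTheory.Limits
open scoped TensorProduct

universe u w

noncomputable section

namespace ExtOrtho

section Tensor

variable (R : Type u) [Ring R] (A : Type*) [Ring A]
  (N : Type u) [AddCommGroup N] [Module R N] [Module A N]

/-- The relations `m r ⊗ n = m ⊗ r n` defining `M ⊗_R N` as a quotient of the tensor product over
`ℤ`, for a right `R`-module `M` and a left `R`-module `N` (the factors are written in the order
`N ⊗ M`, and right `R`-modules are left modules over `Rᵐᵒᵖ`). `A` is a ring acting on `N` by
`R`-linear maps. As `a • (r n ⊗ m - n ⊗ m r) = r (a n) ⊗ m - a n ⊗ m r`, the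
set of relations is stable under `A` and its `A`-span is the additive subgroup it generates. -/
def balancedRel (M : Type u) [AddCommGroup M] [Module Rᵐᵒᵖ M] : Submodule A (N ⊗[ℤ] M) :=
  Submodule.span A
    {t | ∃ (m : M) (r : R) (n : N), t = (r • n) ⊗ₜ[ℤ] m - n ⊗ₜ[ℤ] (MulOpposite.op r • m)}

theorem balancedRel_toAddSubgroup [SMulCommClass R A N] (M : Type u) [AddCommGroup M]
    [Module Rᵐᵒᵖ M] :
    (balancedRel R A N M).toAddSubgroup = AddSubgroup.closure
      {t | ∃ (m : M) (r : R) (n : N), t = (r • n) ⊗ₜ[ℤ] m - n ⊗ₜ[ℤ] (MulOpposite.op r • m)} := by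
  refine le_antisymm (fun x hx => ?_) ((AddSubgroup.closure_le _).2 Submodule.subset_span)
  refine Submodule.closure_induction (p := fun x _ => x ∈ AddSubgroup.closure _) (zero_mem _)
    (fun _ _ _ _ h h' => add_mem h h') ?_ hx
  rintro a _ ⟨m, r, n, rfl⟩
  refine AddSubgroup.subset_closure ⟨m, r, a • n, ?_⟩
  rw [smul_sub, TensorProduct.smul_tmul', TensorProduct.smul_tmul', smul_comm r a n]

/-- The tensor product `M ⊗_R N` over a possibly noncommutative ring, as an `A`-module. -/
abbrev BalancedTensor (M : Type u) [AddCommGroup M] [Module Rᵐᵒᵖ M] : Type u :=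
  (N ⊗[ℤ] M) ⧸ balancedRel R A N M

/-- The element `m ⊗ n` of `M ⊗_R N`. -/
def btmul {M : Type u} [AddCommGroup M] [Module Rᵐᵒᵖ M] (m : M) (n : N) :
    BalancedTensor R A N M :=
  (balancedRel R A N M).mkQ (n ⊗ₜ[ℤ] m)

theorem btmul_balanced {M : Type u} [AddCommGroup M] [Module Rᵐᵒᵖ M] (m : M) (r : R) (n : N) :
    btmul R A N (MulOpposite.op r • m) n = btmul R A N m (r • n) := by
  refine ((Submodule.Quotient.eq _).2 ?_).symm
  exact Submodule.subset_span ⟨m, r, n, rfl⟩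

theorem btmul_add_left {M : Type u} [AddCommGroup M] [Module Rᵐᵒᵖ M] (m m' : M) (n : N) :
    btmul R A N (m + m') n = btmul R A N m n + btmul R A N m' n := by
  simp [btmul, TensorProduct.tmul_add]

theorem smul_btmul {M : Type u} [AddCommGroup M] [Module Rᵐᵒᵖ M] (a : A) (m : M) (n : N) :
    a • btmul R A N m n = btmul R A N m (a • n) := by
  simp only [btmul, ← map_smul, TensorProduct.smul_tmul']

variable {M M' M'' : Type u} [AddCommGroup M] [Module Rᵐᵒᵖ M] [AddCommGroup M'] [Module Rᵐᵒᵖ M']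
  [AddCommGroup M''] [Module Rᵐᵒᵖ M'']

/-- `g ⊗_R N : M ⊗_R N → M' ⊗_R N`. -/
def balancedMap (g : M →ₗ[Rᵐᵒᵖ] M') : BalancedTensor R A N M →ₗ[A] BalancedTensor R A N M' :=
  Submodule.mapQ _ _
    (TensorProduct.AlgebraTensorModule.map (LinearMap.id : N →ₗ[A] N) g.toAddMonoidHom.toIntLinearMap)
    (by
      refine Submodule.span_le.2 ?_
      rintro _ ⟨m, r, n, rfl⟩
      refine Submodule.subset_span ⟨g m, r, n, ?_⟩
      simp)

@[simp]
theorem balancedMap_btmul (g : M →ₗ[Rᵐᵒᵖ] M') (m : M) (n : N) :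
    balancedMap R A N g (btmul R A N m n) = btmul R A N (g m) n :=
  rfl

theorem balanced_hom_ext {P : Type*} [AddCommGroup P] [Module A P]
    {g h : BalancedTensor R A N M →ₗ[A] P}
    (H : ∀ (m : M) (n : N), g (btmul R A N m n) = h (btmul R A N m n)) : g = h := by
  refine Submodule.linearMap_qext _ ?_
  refine TensorProduct.AlgebraTensorModule.ext fun n m => ?_
  exact H m n

/-- The functor `- ⊗_R N` from right `R`-modules to `A`-modules. -/
def tensorFunctor [SMulCommClass R A N] : ModuleCat.{u} Rᵐᵒᵖ ⥤ ModuleCat.{u} A where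
  obj M := ModuleCat.of A (BalancedTensor R A N M)
  map g := ModuleCat.ofHom (balancedMap R A N g.hom)
  map_id M := by
    ext1
    exact balanced_hom_ext R A N fun m n => by simp
  map_comp g h := by
    ext1
    exact balanced_hom_ext R A N fun m n => by simp

instance [SMulCommClass R A N] : (tensorFunctor R A N).Additive where
  map_add {M M' g h} := by
    ext1
    exact balanced_hom_ext R A N fun m n => btmul_add_left R A N (g.hom m) (h.hom m) n

/-- `Tor_i^R(-, N)`, the left derived functors of `- ⊗_R N`. -/
def torFunctor [SMulCommClass R A N] (i : ℕ) : ModuleCat.{u} Rᵐᵒᵖ ⥤ ModuleCat.{u} A :=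
  (tensorFunctor R A N).leftDerived i

end Tensor

/-- `w.gl.dim R ≤ 1`: `Tor_2^R(M, N) = 0` for all right modules `M` and left modules `N`
(here `Tor` is an abelian group, i.e. `A = ℤ`). -/
def WeakGlobalDimLEOne (R : Type u) [Ring R] : Prop :=
  ∀ (M : ModuleCat.{u} Rᵐᵒᵖ) (N : ModuleCat.{u} R), IsZero ((torFunctor R ℤ N 2).obj M)

section Hom

variable {R S : Type u} [Ring R] [Ring S] (f : R →+* S)

/-- `S` as an `R`-`S`-bimodule along `f : R → S`. -/
def AsBimodule (_f : R →+* S) : Type u := S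

instance : AddCommGroup (AsBimodule f) := inferInstanceAs (AddCommGroup S)

instance : Module Sᵐᵒᵖ (AsBimodule f) := inferInstanceAs (Module Sᵐᵒᵖ S)

instance : Module R (AsBimodule f) := Module.compHom S f

instance : SMulCommClass R Sᵐᵒᵖ (AsBimodule f) where
  smul_comm r s x := (mul_assoc (f r) (x : S) s.unop).symm

/-- Restriction of scalars `f_* : Mod-S ⥤ Mod-R`. -/
abbrev restrict : ModuleCat.{u} Sᵐᵒᵖ ⥤ ModuleCat.{u} Rᵐᵒᵖ :=
  ModuleCat.restrictScalars (RingHom.op f)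

/-- `- ⊗_R S : Mod-R ⥤ Mod-S`. -/
abbrev tensorS : ModuleCat.{u} Rᵐᵒᵖ ⥤ ModuleCat.{u} Sᵐᵒᵖ :=
  tensorFunctor R Sᵐᵒᵖ (AsBimodule f)

/-- `Tor_i^R(-, S) : Mod-R ⥤ Mod-S`. -/
abbrev torS (i : ℕ) : ModuleCat.{u} Rᵐᵒᵖ ⥤ ModuleCat.{u} Sᵐᵒᵖ :=
  torFunctor R Sᵐᵒᵖ (AsBimodule f) i

/-- The canonical map `M → M ⊗_R S`, `m ↦ m ⊗ 1`, natural in `M`. -/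
def unitS : 𝟭 (ModuleCat.{u} Rᵐᵒᵖ) ⟶ tensorS f ⋙ restrict f where
  app M := ModuleCat.ofHom (Y := (restrict f).obj ((tensorS f).obj M))
    { toFun := fun m => btmul R Sᵐᵒᵖ (AsBimodule f) m (1 : S)
      map_add' := fun m m' => btmul_add_left R Sᵐᵒᵖ (AsBimodule f) m m' (1 : S)
      map_smul' := fun r m => by
        refine (btmul_balanced R Sᵐᵒᵖ (AsBimodule f) m r.unop (1 : S)).trans ?_
        refine Eq.trans ?_
          (smul_btmul R Sᵐᵒᵖ (AsBimodule f) (RingHom.op f r) m (1 : S)).symm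
        congr 1
        exact (mul_one (f r.unop)).trans (one_mul (f r.unop)).symm }
  naturality M M' g := by
    ext m
    exact (balancedMap_btmul R Sᵐᵒᵖ (AsBimodule f) g.hom m (1 : S)).symm

/-- The class `𝒳₀` of right `R`-modules `X` with `X ⊗_R S = 0 = Tor_1^R(X, S)`. -/
def classX : ObjectProperty (ModuleCat.{u} Rᵐᵒᵖ) := fun X =>
  IsZero ((tensorS f).obj X) ∧ IsZero ((torS f 1).obj X)

/-- `Mod-S` as a class of right `R`-modules: the essential image of restriction of scalars. -/
def classS : ObjectProperty (ModuleCat.{u} Rᵐᵒᵖ) := (restrict f).essImage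

end Hom

/-- A homomorphism of `k`-algebras is a homological epimorphism if it is an epimorphism in the
category of `k`-algebras and `Tor_i^R(S, S) = 0` for all `i ≥ 1`. -/
def IsHomologicalEpi {k : Type w} [CommRing k] {R S : Type u} [Ring R] [Ring S] [Algebra k R]
    [Algebra k S] (f : R →ₐ[k] S) : Prop :=
  Epi (AlgCat.ofHom f) ∧
    ∀ i : ℕ, 1 ≤ i →
      IsZero ((torS f.toRingHom i).obj ((restrict f.toRingHom).obj (ModuleCat.of Sᵐᵒᵖ S)))

section Cat

variable {C : Type*} [Category* C]

/-- `r : M ⟶ Y` is a reflection of `M` into the full subcategory of objects satisfying `P`. -/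
def IsReflection (P : ObjectProperty C) {M Y : C} (r : M ⟶ Y) : Prop :=
  P Y ∧ ∀ (Y' : C), P Y' → ∀ g : M ⟶ Y', ∃! h : Y ⟶ Y', r ≫ h = g

/-- `c : X ⟶ M` is a coreflection of `M` into the full subcategory of objects satisfying `P`. -/
def IsCoreflection (P : ObjectProperty C) {X M : C} (c : X ⟶ M) : Prop :=
  P X ∧ ∀ (X' : C), P X' → ∀ g : X' ⟶ M, ∃! h : X' ⟶ X, h ≫ c = g

/-- `0 → E₀ → E₁ → E₂ → E₃ → E₄ → 0` is exact. -/
structure IsFiveTermExact [Abelian C] (E : ComposableArrows C 4) : Prop where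
  mono : Mono (E.map' 0 1)
  exact : E.Exact
  epi : Epi (E.map' 3 4)

end Cat

/-- The sequences `ε_M` with `E₂ = M`: five-term exact sequences in which `E₁ → E₂` is an
`𝒳₀`-coreflection and `E₂ → E₃` is a `Mod-S`-reflection. -/
structure IsApproxSeq {R S : Type u} [Ring R] [Ring S] (f : R →+* S)
    (E : ComposableArrows (ModuleCat.{u} Rᵐᵒᵖ) 4) : Prop where
  exact : IsFiveTermExact E
  coreflection : IsCoreflection (classX f) (E.map' 1 2)
  reflection : IsReflection (classS f) (E.map' 2 3)

end ExtOrtho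

end

-- Write T for - ⊗_R S. Since f is an epimorphism, restriction is full, so M → T M is a reflection
-- onto Mod-S and T inverts it. Then Tor_1(S, S) = 0 gives Tor_1(Y, S) = 0 for every S-module Y
-- (`torAcyclic_restrict`), and w.gl.dim R ≤ 1 makes the condition Tor_1(-, S) = 0 pass to
-- submodules (`TorAcyclic.of_mono`).
--
-- The term that has to be invented is X_M. Take the free cover 0 → K → F → M → 0 and let Q be the
-- pushout of F along K → T K. Then Q is an extension of M by T K, Tor_1(Q, S) = 0, and T inverts
-- the induced map Q → T F. Put X_M = ker (Q → T F); it lies in 𝒳₀ by `classX_of_isKernel`. A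
-- diagram chase (`fiveTerm_exact`) shows that X_M → M has kernel ker (T K → T F) = Tor_1(M, S) and
-- image ker (M → T M). The cokernel X^M of M → T M lies in 𝒳₀ by `classX_cokernel`.
--
-- Part (2) is orthogonality: Hom and Ext¹ from 𝒳₀ to Mod-S vanish (`hom_eq_zero`,
-- `exists_retraction`). In part (3) the universal properties determine the components at E₁ and E₃,
-- and these determine the outer ones. Direct limits are preserved because every term arises by
-- kernels, cokernels and pushouts from a functorial free cover that preserves them.
--
-- Long exact Tor sequences are replaced by `IsTAcyclic`, which is equivalent to the vanishing of
-- the first derived functor and can be handled with pullbacks alone.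

universe v

noncomputable section

namespace ExtOrtho

/-! ### Tensor-hom and extension-restriction adjunctions. -/

section Adjunction

variable (R : Type u) [Ring R] (A : Type*) [Ring A]
  (N : Type u) [AddCommGroup N] [Module R N] [Module A N]

/-- A balanced biadditive map that is `A`-linear in the second variable induces an `A`-linear map
on `M ⊗_R N`. -/
def balancedLift {M P : Type u} [AddCommGroup M] [Module Rᵐᵒᵖ M] [AddCommGroup P] [Module A P]
    (φ : M →+ (N →ₗ[A] P)) (hφ : ∀ m (r : R) n, φ (MulOpposite.op r • m) n = φ m (r • n)) :
    BalancedTensor R A N M →ₗ[A] P :=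
  Submodule.liftQ _
    (TensorProduct.AlgebraTensorModule.lift
      { toFun := fun n =>
          ({ toFun := fun m => φ m n
             map_zero' := by simp
             map_add' := by simp } : M →+ P).toIntLinearMap
        map_add' := fun n n' => by ext; simp
        map_smul' := fun a n => by ext; simp })
    (by
      refine Submodule.span_le.2 ?_
      rintro _ ⟨m, r, n, rfl⟩
      simp [hφ])

/-- `m ↦ (n ↦ m ⊗ n)`. -/
def btmulHom (M : Type u) [AddCommGroup M] [Module Rᵐᵒᵖ M] :
    M →+ (N →ₗ[A] BalancedTensor R A N M) where
  toFun m :=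
    { toFun := fun n => btmul R A N m n
      map_add' := fun n n' => by simp [btmul, TensorProduct.add_tmul]
      map_smul' := fun a n => (smul_btmul R A N a m n).symm }
  map_zero' := by ext; simp [btmul]
  map_add' m m' := by ext n; exact btmul_add_left R A N m m' n

variable [SMulCommClass R A N]

/-- `Hom_A(N, P)`, with right `R`-module structure induced by the left `R`-module `N`. -/
def BimoduleHom (P : Type u) [AddCommGroup P] [Module A P] : Type u := N →ₗ[A] P

instance (P : Type u) [AddCommGroup P] [Module A P] : AddCommGroup (BimoduleHom A N P) :=
  inferInstanceAs (AddCommGroup (N →ₗ[A] P))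

instance (P : Type u) [AddCommGroup P] [Module A P] : Module Rᵐᵒᵖ (BimoduleHom A N P) :=
  haveI : SMulCommClass A R N := SMulCommClass.symm R A N
  -- `Rᵈᵐᵃ`, acting on the domain of a map, unfolds to `Rᵐᵒᵖ`.
  inferInstanceAs (Module Rᵈᵐᵃ (N →ₗ[A] P))

/-- The functor `Hom_A(N, -)` from `A`-modules to right `R`-modules. -/
def bimoduleHomFunctor : ModuleCat.{u} A ⥤ ModuleCat.{u} Rᵐᵒᵖ where
  obj P := ModuleCat.of Rᵐᵒᵖ (BimoduleHom A N P)
  map g := ModuleCat.ofHom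
    { toFun := fun φ => g.hom.comp (show N →ₗ[A] _ from φ)
      map_add' := fun φ ψ => LinearMap.comp_add _ _ _
      map_smul' := fun r φ => by
        refine LinearMap.ext fun n => rfl }

/-- The tensor-hom adjunction. -/
def tensorHomAdj : tensorFunctor R A N ⊣ bimoduleHomFunctor R A N :=
  Adjunction.mkOfHomEquiv
    { homEquiv := fun M P =>
        { toFun := fun g => ModuleCat.ofHom (Y := BimoduleHom A N P)
            { toFun := fun m => g.hom.comp (btmulHom R A N M m)
              map_add' := fun m m' => by
                rw [map_add]; exact LinearMap.comp_add _ _ _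
              map_smul' := fun r m => by
                refine LinearMap.ext fun n => ?_
                exact congrArg g.hom (btmul_balanced R A N m r.unop n) }
          invFun := fun φ => ModuleCat.ofHom
            (balancedLift R A N (M := M) (P := P)
              (show M →+ (N →ₗ[A] P) from φ.hom.toAddMonoidHom) (fun m r n => by
                refine (LinearMap.congr_fun (φ.hom.map_smul (MulOpposite.op r) m) n).trans rfl))
          left_inv := fun g => by
            ext1
            exact balanced_hom_ext R A N fun m n => rfl
          right_inv := fun φ => rfl }
      homEquiv_naturality_left_symm := fun g h => by
        ext1
        exact balanced_hom_ext R A N fun m n => rfl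
      homEquiv_naturality_right := fun g h => rfl }

/-- This is the source of right exactness of the tensor product, for every acting ring `A`. -/
instance : (tensorFunctor R A N).IsLeftAdjoint := (tensorHomAdj R A N).isLeftAdjoint

end Adjunction

section Restrict

variable {R S : Type u} [Ring R] [Ring S] (f : R →+* S)

/-- Extension of scalars along `f` is left adjoint to restriction; the unit is `m ↦ m ⊗ 1`. -/
def tensorRestrictAdj : tensorS f ⊣ restrict f :=
  Adjunction.mkOfHomEquiv
    { homEquiv := fun M P =>
        { toFun := fun g => (unitS f).app M ≫ (restrict f).map g
          invFun := fun φ => ModuleCat.ofHom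
            (balancedLift R Sᵐᵒᵖ (AsBimodule f) (M := M) (P := P)
              { toFun := fun m =>
                  { toFun := fun s => MulOpposite.op (show S from s) • (show P from φ.hom m)
                    map_add' := fun s s' => add_smul (MulOpposite.op (show S from s))
                      (MulOpposite.op (show S from s')) (show P from φ.hom m)
                    map_smul' := fun a s => mul_smul a (MulOpposite.op (show S from s))
                      (show P from φ.hom m) }
                map_zero' := by
                  refine LinearMap.ext fun s => ?_
                  refine (congrArg (fun x : P => MulOpposite.op (show S from s) • x)
                    (map_zero φ.hom)).trans
                    (smul_zero (M := Sᵐᵒᵖ) (A := P) (MulOpposite.op (show S from s)))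
                map_add' := fun m m' => by
                  refine LinearMap.ext fun s => ?_
                  refine (congrArg (fun x : P => MulOpposite.op (show S from s) • x)
                    (map_add φ.hom m m')).trans
                    (smul_add (M := Sᵐᵒᵖ) (A := P) (MulOpposite.op (show S from s)) _ _) }
              (fun m r s => by
                refine (congrArg (fun x : P => MulOpposite.op (show S from s) • x)
                  (map_smul φ.hom (MulOpposite.op r) m)).trans ?_
                exact (mul_smul (MulOpposite.op (show S from s)) (MulOpposite.op (f r))
                  (show P from φ.hom m)).symm))
          left_inv := fun g => by
            ext1
            refine balanced_hom_ext R Sᵐᵒᵖ (AsBimodule f) fun m s => ?_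
            refine (map_smul g.hom (MulOpposite.op (show S from s))
              (btmul R Sᵐᵒᵖ (AsBimodule f) m (1 : S))).symm.trans ?_
            refine congrArg g.hom ((smul_btmul R Sᵐᵒᵖ (AsBimodule f) _ m (1 : S)).trans ?_)
            exact congrArg (btmul R Sᵐᵒᵖ (AsBimodule f) m) (one_mul (show S from s))
          right_inv := fun φ => by
            ext m
            exact one_smul Sᵐᵒᵖ (show P from φ.hom m) }
      homEquiv_naturality_left_symm := fun g h => by
        ext1
        exact balanced_hom_ext R Sᵐᵒᵖ (AsBimodule f) fun m n => rfl
      homEquiv_naturality_right := fun g h => rfl }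

theorem tensorRestrictAdj_unit : (tensorRestrictAdj f).unit = unitS f := by
  refine NatTrans.ext (funext fun M => ?_)
  rw [← Adjunction.homEquiv_id, tensorRestrictAdj, Adjunction.mkOfHomEquiv_homEquiv]
  refine (congrArg ((unitS f).app M ≫ ·) ((restrict f).map_id _)).trans ?_
  exact Category.comp_id _

end Restrict

/-! ### Restriction along an epimorphism is full. -/

section Epi

variable {k : Type w} [CommRing k] {R S : Type u} [Ring R] [Ring S] [Algebra k R] [Algebra k S]

/-- The `k`-algebra homomorphism `S → (End_k V)ᵒᵖ` of a right `S`-module `V`. -/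
def rightAction (V : Type u) [AddCommGroup V] [Module k V] [Module Sᵐᵒᵖ V]
    [IsScalarTower k Sᵐᵒᵖ V] : S →ₐ[k] (Module.End k V)ᵐᵒᵖ :=
  AlgHom.opComm.symm (Algebra.lsmul k k V)

/-- The automorphism `(m, n) ↦ (m, n + g m)` of `M × N`. -/
def shear {M N : Type u} [AddCommGroup M] [AddCommGroup N] [Module k M] [Module k N]
    (g : M →ₗ[k] N) : (M × N) ≃ₗ[k] (M × N) :=
  { toFun := fun x => (x.1, x.2 + g x.1)
    invFun := fun x => (x.1, x.2 - g x.1)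
    map_add' := fun x y => by ext <;> simp; abel
    map_smul' := fun c x => by ext <;> simp
    left_inv := fun x => by ext <;> simp
    right_inv := fun x => by ext <;> simp }

/-- Conjugating the S-action on M × N by (m, n) ↦ (m, n + g m) gives a second action. As g is
R-linear, both agree on R, hence they are equal because f is an epimorphism. Evaluating at (m, 0)
and reading the second coordinate shows that g is S-linear. -/
theorem map_op_smul_of_epi (f : R →ₐ[k] S) (hf : Epi (AlgCat.ofHom f)) {M N : Type u}
    [AddCommGroup M] [AddCommGroup N] [Module Sᵐᵒᵖ M] [Module Sᵐᵒᵖ N] (g : M →+ N)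
    (hg : ∀ (r : R) (m : M), g (MulOpposite.op (f r) • m) = MulOpposite.op (f r) • g m)
    (s : S) (m : M) : g (MulOpposite.op s • m) = MulOpposite.op s • g m := by
  -- The epimorphism can only be tested against k-algebras, so k is made to act through S and the
  -- actions take values in k-linear endomorphisms.
  let _ : Module k M := Module.compHom M (algebraMap k Sᵐᵒᵖ)
  let _ : Module k N := Module.compHom N (algebraMap k Sᵐᵒᵖ)
  have : IsScalarTower k Sᵐᵒᵖ M := ⟨fun a s m => by
    rw [Algebra.smul_def, mul_smul]; rfl⟩
  have : IsScalarTower k Sᵐᵒᵖ N := ⟨fun a s m => by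
    rw [Algebra.smul_def, mul_smul]; rfl⟩
  let g' : M →ₗ[k] N :=
    { g with
      map_smul' := fun c m => by
        have := hg (algebraMap k R c) m
        rw [f.commutes] at this
        exact this }
  let ρ : S →ₐ[k] (Module.End k (M × N))ᵐᵒᵖ := rightAction (M × N)
  let σ : S →ₐ[k] (Module.End k (M × N))ᵐᵒᵖ :=
    (AlgEquiv.op (LinearEquiv.conjAlgEquiv k (shear g'))).toAlgHom.comp ρ
  have key : ρ.comp f = σ.comp f := by
    ext r : 1
    refine MulOpposite.unop_injective (LinearMap.ext fun x => ?_)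
    change MulOpposite.op (f r) • x =
      shear g' (MulOpposite.op (f r) • (shear g').symm x)
    rw [← LinearEquiv.symm_apply_eq]
    ext
    · rfl
    · change MulOpposite.op (f r) • x.2 - g (MulOpposite.op (f r) • x.1) =
        MulOpposite.op (f r) • (x.2 - g x.1)
      rw [hg, smul_sub]
  have h : AlgCat.ofHom ρ = AlgCat.ofHom σ := by
    rw [← cancel_epi (AlgCat.ofHom f), ← AlgCat.ofHom_comp, ← AlgCat.ofHom_comp, key]
  have h' : ρ s = σ s := congrArg (fun φ => φ.hom s) h
  have h'' : MulOpposite.op s • ((m, 0) : M × N) =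
      shear g' (MulOpposite.op s • (shear g').symm (m, 0)) :=
    LinearMap.congr_fun (congrArg MulOpposite.unop h') (m, 0)
  have h3 := congrArg Prod.snd h''
  change MulOpposite.op s • (0 : N) =
    MulOpposite.op s • (0 - g m) + g (MulOpposite.op s • m) at h3
  rw [smul_zero, zero_sub, smul_neg] at h3
  exact (neg_add_eq_zero.1 h3.symm).symm

theorem restrict_full (f : R →ₐ[k] S) (hf : Epi (AlgCat.ofHom f)) :
    (restrict f.toRingHom).Full where
  map_surjective {M N} g :=
    ⟨ModuleCat.ofHom
      { toFun := g.hom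
        map_add' := map_add g.hom
        map_smul' := fun s m => map_op_smul_of_epi f hf (M := M) (N := N)
          g.hom.toAddMonoidHom (fun r m => g.hom.map_smul' (MulOpposite.op r) m) s.unop m }, rfl⟩

end Epi

/-! ### The unit M → M ⊗_R S as a reflection. -/

section Reflection

variable {R S : Type u} [Ring R] [Ring S] (f : R →+* S)

instance : (tensorS f).IsLeftAdjoint := (tensorRestrictAdj f).isLeftAdjoint

theorem isReflection_unitS [(restrict f).Full] (M : ModuleCat.{u} Rᵐᵒᵖ) :
    IsReflection (classS f) ((unitS f).app M) := by
  refine ⟨(restrict f).obj_mem_essImage _, ?_⟩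
  rintro Y ⟨N, ⟨e⟩⟩ g
  rw [← tensorRestrictAdj_unit]
  let adj := tensorRestrictAdj f
  refine ⟨(restrict f).map ((adj.homEquiv M N).symm (g ≫ e.inv)) ≫ e.hom, ?_, fun h' hh' => ?_⟩
  · have := adj.homEquiv_unit (f := (adj.homEquiv M N).symm (g ≫ e.inv))
    rw [Equiv.apply_symm_apply] at this
    change adj.unit.app M ≫ _ ≫ _ = _
    rw [← Category.assoc, ← this, Category.assoc, e.inv_hom_id, Category.comp_id]
  · obtain ⟨l, hl⟩ := (restrict f).map_surjective (h' ≫ e.inv)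
    have : adj.homEquiv M N l = g ≫ e.inv := by
      rw [adj.homEquiv_unit, hl, ← hh', Category.assoc]
    rw [← this, Equiv.symm_apply_apply, hl, Category.assoc, e.inv_hom_id, Category.comp_id]

theorem isIso_unitS_app [(restrict f).Full] {M : ModuleCat.{u} Rᵐᵒᵖ} (hM : classS f M) :
    IsIso ((unitS f).app M) := by
  rw [← tensorRestrictAdj_unit]
  exact ((tensorRestrictAdj f).isIso_unit_app_iff_mem_essImage).2 hM

theorem isIso_tensorS_unitS_app [(restrict f).Full] (M : ModuleCat.{u} Rᵐᵒᵖ) :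
    IsIso ((tensorS f).map ((unitS f).app M)) := by
  rw [← tensorRestrictAdj_unit]
  infer_instance

end Reflection

/-! ### Pullbacks and pushouts of short exact sequences. -/

section ShortExact

variable {C : Type*} [Category* C] [Abelian C]

theorem shortExact_lift_of_isPullback {A B M P E : C} {i : A ⟶ B} {p : B ⟶ M} {w : i ≫ p = 0}
    (h : (ShortComplex.mk i p w).ShortExact) {a : E ⟶ B} {b : E ⟶ P} {q : P ⟶ M}
    (sq : IsPullback a b p q) :
    (ShortComplex.mk (sq.lift i 0 (by simp [w])) b (by simp)).ShortExact := by
  have := h.mono_f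
  have := h.epi_g
  dsimp at *
  have hm : Mono (sq.lift i 0 (by simp [w])) :=
    mono_of_mono_fac (sq.lift_fst i 0 (by simp [w]))
  have he : Epi b := Abelian.epi_snd_of_isLimit _ _ sq.isLimit
  refine { exact := ShortComplex.exact_of_f_is_kernel _ (KernelFork.IsLimit.ofι' _ _
    fun {W} k hk => ?_), mono_f := hm, epi_g := he }
  have hz : (k ≫ a) ≫ p = 0 := by
    rw [Category.assoc, sq.w, reassoc_of% hk, zero_comp]
  refine ⟨h.exact.lift (k ≫ a) hz, sq.hom_ext ?_ ?_⟩
  · simpa using h.exact.lift_f (k ≫ a) hz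
  · simpa using hk.symm

theorem shortExact_desc_of_isPushout {A B M N E : C} {i : A ⟶ B} {p : B ⟶ M} {w : i ≫ p = 0}
    (h : (ShortComplex.mk i p w).ShortExact) {a : A ⟶ N} {b : B ⟶ E} {j : N ⟶ E}
    (sq : IsPushout i a b j) :
    (ShortComplex.mk j (sq.desc p 0 (by simp [w])) (by simp)).ShortExact := by
  have := h.mono_f
  have := h.epi_g
  dsimp at *
  have he : Epi (sq.desc p 0 (by simp [w])) :=
    epi_of_epi_fac (sq.inl_desc p 0 (by simp [w]))
  have hm : Mono j := Abelian.mono_inr_of_isColimit _ _ sq.isColimit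
  refine { exact := ShortComplex.exact_of_g_is_cokernel _ (CokernelCofork.IsColimit.ofπ' _ _
    fun {W} k hk => ?_), mono_f := hm, epi_g := he }
  have hz : i ≫ b ≫ k = 0 := by
    rw [sq.w_assoc, hk, comp_zero]
  refine ⟨h.exact.desc (b ≫ k) hz, sq.hom_ext ?_ ?_⟩
  · simpa using h.exact.g_desc (b ≫ k) hz
  · simpa using hk.symm

/-- As p is epi, the preimage E of X satisfies P/E = Y/X = Z. -/
theorem shortExact_fst_of_isPullback {X Y Z P E : C} {i : X ⟶ Y} {g : Y ⟶ Z} {w : i ≫ g = 0}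
    (h : (ShortComplex.mk i g w).ShortExact) {a : E ⟶ P} {b : E ⟶ X} {p : P ⟶ Y} [Epi p]
    (sq : IsPullback a b p i) :
    (ShortComplex.mk a (p ≫ g) (by rw [sq.w_assoc, w, comp_zero])).ShortExact := by
  have := h.mono_f
  have := h.epi_g
  dsimp at *
  have hm : Mono a := ⟨fun k l hkl => sq.hom_ext hkl (by
    rw [← cancel_mono i, Category.assoc, Category.assoc, ← sq.w, reassoc_of% hkl])⟩
  refine { exact := ShortComplex.exact_of_f_is_kernel _ (KernelFork.IsLimit.ofι' _ _
    fun {W} k hk => ?_), mono_f := hm, epi_g := epi_comp p g }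
  have hz : (k ≫ p) ≫ g = 0 := by simpa using hk
  have e : k ≫ p = h.exact.lift (k ≫ p) hz ≫ i := (h.exact.lift_f (k ≫ p) hz).symm
  exact ⟨sq.lift k _ e, sq.lift_fst k _ e⟩

end ShortExact

/-! ### Acyclic objects of a right exact functor. -/

section Acyclic

theorem mono_of_injective_zero {A : Type*} [Ring A] {X Y : ModuleCat.{v} A} (f : X ⟶ Y)
    (h : ∀ x, f x = 0 → x = 0) : Mono f :=
  (ModuleCat.mono_iff_injective f).2 ((injective_iff_map_eq_zero f.hom).2 h)

theorem eq_zero_of_mono {A : Type*} [Ring A] {X Y : ModuleCat.{v} A} (f : X ⟶ Y) [Mono f]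
    {x : X} (h : f x = 0) : x = 0 :=
  (injective_iff_map_eq_zero f.hom).1 ((ModuleCat.mono_iff_injective f).1 inferInstance) x h

variable {C : Type*} [Category* C] [Abelian C] {A : Type*} [Ring A]
  (T : C ⥤ ModuleCat.{v} A)

/-- `M` is acyclic for the right exact functor `T` if `T` preserves the exactness of all short
exact sequences `0 → X → Y → M → 0`. -/
def IsTAcyclic (M : C) : Prop :=
  ∀ ⦃X Y : C⦄ (i : X ⟶ Y) (p : Y ⟶ M) (w : i ≫ p = 0),
    (ShortComplex.mk i p w).ShortExact → Mono (T.map i)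

variable {T}

theorem isTAcyclic_of_projective (M : C) [Projective M] : IsTAcyclic T M := by
  intro X Y i p w hS
  have : Projective (ShortComplex.mk i p w).X₃ := ‹_›
  have : IsSplitMono i := ⟨⟨hS.splittingOfProjective.splitMono_f⟩⟩
  infer_instance

/-- For a cover P → Y with kernel K, let E be the preimage of X. Then T K → T P factors as T K → T E
→ T P; the first map is mono since E/K = X is acyclic, the second since P/E = Z is. -/
theorem IsTAcyclic.extension {X Y Z : C} {i : X ⟶ Y} {g : Y ⟶ Z} {w : i ≫ g = 0}
    (hS : (ShortComplex.mk i g w).ShortExact) (hX : IsTAcyclic T X) (hZ : IsTAcyclic T Z) :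
    IsTAcyclic T Y := by
  intro K P j p w' hP
  have : Epi p := hP.epi_g
  have sq := IsPullback.of_hasPullback p i
  have := hX _ _ _ (shortExact_lift_of_isPullback hP sq)
  have := hZ _ _ _ (shortExact_fst_of_isPullback hS sq)
  rw [← sq.lift_fst j 0 (by simp [w']), T.map_comp]
  exact mono_comp _ _

/-- Pull P → M back along r to E. The mono T K → T E factors through T K → T P, because the section
s induces a map P → E. -/
theorem IsTAcyclic.retract {M M' : C} (h : IsTAcyclic T M') (s : M ⟶ M') (r : M' ⟶ M)
    (hsr : s ≫ r = 𝟙 M) : IsTAcyclic T M := by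
  intro K P j p w hP
  have sq := IsPullback.of_hasPullback p r
  have hE := h _ _ _ (shortExact_lift_of_isPullback hP sq)
  have e : 𝟙 P ≫ p = (p ≫ s) ≫ r := by simp [hsr]
  have : sq.lift j 0 (by simp [w]) = j ≫ sq.lift (𝟙 P) (p ≫ s) e :=
    sq.hom_ext (by simp) (by simp [reassoc_of% w])
  rw [this, T.map_comp] at hE
  exact mono_of_mono (T.map j) (T.map (sq.lift (𝟙 P) (p ≫ s) e))

theorem IsTAcyclic.of_iso {M M' : C} (h : IsTAcyclic T M) (e : M ≅ M') : IsTAcyclic T M' :=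
  h.retract e.inv e.hom (by simp)

theorem IsTAcyclic.biprod {M M' : C} (h : IsTAcyclic T M) (h' : IsTAcyclic T M') :
    IsTAcyclic T (M ⊞ M') :=
  IsTAcyclic.extension (i := biprod.inl) (g := biprod.snd) (w := by simp)
    (ShortComplex.Splitting.ofHasBinaryBiproduct M M').shortExact h h'

variable [T.Additive] [PreservesFiniteColimits T]

theorem exact_map {X Y M : C} {i : X ⟶ Y} {p : Y ⟶ M} {w : i ≫ p = 0}
    (hS : (ShortComplex.mk i p w).ShortExact) (y : T.obj Y) (hy : T.map p y = 0) :
    ∃ x, T.map i x = y := by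
  have := hS.epi_g
  exact (ShortComplex.moduleCat_exact_iff _).1
    (hS.exact.map_of_epi_of_preservesCokernel T inferInstance inferInstance) y hy

/-- A middle term of two short exact sequences ending in `M` and `P`. -/
theorem mono_map_of_isPullback {X Y K P M E : C} {i : X ⟶ Y} {p : Y ⟶ M} {w : i ≫ p = 0}
    (hY : (ShortComplex.mk i p w).ShortExact) {j : K ⟶ P} {q : P ⟶ M} {w' : j ≫ q = 0}
    {a : E ⟶ Y} {b : E ⟶ P}
    (sq : IsPullback a b p q) (hi : Mono (T.map i))
    (hj : Mono (T.map (sq.lift 0 j (by simp [w'])))) : Mono (T.map j) := by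
  have hE := shortExact_lift_of_isPullback hY sq
  refine mono_of_injective_zero _ fun x hx => ?_
  -- An element of ker (T K → T P) comes, inside T E, from some y in T X. Its image in T Y vanishes
  -- because K → E → Y is zero, so y = 0.
  have h1 : T.map b (T.map (sq.lift 0 j (by simp [w'])) x) = 0 := by
    rw [← ConcreteCategory.comp_apply, ← T.map_comp, sq.lift_snd, hx]
  obtain ⟨y, hy⟩ := exact_map hE _ h1
  have h2 : T.map i y = 0 := by
    have := congrArg (T.map a) hy
    rw [← ConcreteCategory.comp_apply, ← ConcreteCategory.comp_apply, ← T.map_comp, ← T.map_comp,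
      sq.lift_fst, sq.lift_fst, T.map_zero] at this
    exact this
  rw [eq_zero_of_mono _ h2, map_zero] at hy
  exact eq_zero_of_mono _ hy.symm

/-- Stands in for exactness of L₁T Y → L₁T M → T X → T Y: one presentation with acyclic middle term
decides the acyclicity of M. -/
theorem IsTAcyclic.of_mono {X Y M : C} {i : X ⟶ Y} {p : Y ⟶ M} {w : i ≫ p = 0}
    (hS : (ShortComplex.mk i p w).ShortExact) (hY : IsTAcyclic T Y) (hi : Mono (T.map i)) :
    IsTAcyclic T M := by
  intro K P j q w' hP
  have sq := IsPullback.of_hasPullback p q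
  have hE := shortExact_lift_of_isPullback hP sq.flip
  refine mono_map_of_isPullback hS (w' := w') sq hi ?_
  convert hY _ _ _ hE using 2
  exact sq.hom_ext (by simp) (by simp)

end Acyclic

/-! ### Derived functors and syzygies of a projective resolution. -/

section Derived

variable {C : Type*} [Category* C] [Abelian C]

/-- By exactness `opcycles (n + 1)` is a syzygy of M embedded in P_n. Opcycles are used rather than
cycles because they are cokernels, which a right exact T preserves. -/
theorem mono_fromOpcycles {M : C} (P : ProjectiveResolution M) (n : ℕ) :
    Mono (P.complex.fromOpcycles (n + 1) n) := by
  have hz : IsZero (P.complex.homology (n + 1)) :=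
    (HomologicalComplex.exactAt_iff_isZero_homology _ _).1 (P.complex_exactAt_succ n)
  have hk := P.complex.homologyIsKernel (n + 1) n (by simp)
  refine Preadditive.mono_of_cancel_zero _ fun g hg => ?_
  obtain ⟨l, hl⟩ := KernelFork.IsLimit.lift' hk g hg
  rw [← hl, hz.eq_of_tgt l 0, zero_comp]

/-- The augmentation `P₀ → M` of a projective resolution. -/
def augmentation {M : C} (P : ProjectiveResolution M) : P.complex.X 0 ⟶ M := P.π.f 0

theorem d_comp_augmentation {M : C} (P : ProjectiveResolution M) :
    P.complex.d 1 0 ≫ augmentation P = 0 :=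
  P.complex_d_comp_π_f_zero

instance {M : C} (P : ProjectiveResolution M) : Epi (augmentation P) :=
  inferInstanceAs (Epi (P.π.f 0))

theorem lift_comp_augmentation {M N : C} (g : M ⟶ N) (P : ProjectiveResolution M)
    (Q : ProjectiveResolution N) :
    (ProjectiveResolution.lift g P Q).f 0 ≫ augmentation Q = augmentation P ≫ g :=
  ProjectiveResolution.lift_commutes_zero g P Q

theorem shortExact_fromOpcycles_zero {M : C} (P : ProjectiveResolution M) :
    (ShortComplex.mk (P.complex.fromOpcycles 1 0) (augmentation P) (by
      rw [← cancel_epi (P.complex.pOpcycles 1), HomologicalComplex.p_fromOpcycles_assoc,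
        d_comp_augmentation, comp_zero])).ShortExact where
  mono_f := mono_fromOpcycles P 0
  epi_g := inferInstanceAs (Epi (augmentation P))
  exact := (ShortComplex.exact_iff_of_epi_of_isIso_of_mono
    (S₁ := ShortComplex.mk (P.complex.d 1 0) (augmentation P) (d_comp_augmentation P))
    { τ₁ := P.complex.pOpcycles 1
      τ₂ := 𝟙 (P.complex.X 0)
      τ₃ := 𝟙 M }).1 P.exact₀

theorem shortExact_fromOpcycles_one {M : C} (P : ProjectiveResolution M) :
    (ShortComplex.mk (P.complex.fromOpcycles 2 1) (P.complex.pOpcycles 1) (by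
      rw [← cancel_epi (P.complex.pOpcycles 2)]; simp)).ShortExact where
  mono_f := mono_fromOpcycles P 1
  epi_g := inferInstanceAs (Epi (P.complex.pOpcycles 1))
  exact := ShortComplex.exact_of_g_is_cokernel _ (by
    refine CokernelCofork.IsColimit.ofπ' _ _ fun {W} k hk => ?_
    have h : P.complex.d 2 1 ≫ k = 0 := by
      rw [← P.complex.p_fromOpcycles 2 1, Category.assoc]
      dsimp at hk
      rw [hk, comp_zero]
    exact ⟨P.complex.descOpcycles k 2 (by simp) h, P.complex.p_descOpcycles k 2 (by simp) h⟩)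

section

variable {D : Type*} [Category* D] [Abelian D] {Y Y' : ChainComplex D ℕ} {N N' : D}

/-- The map `H₁(Y) → N` induced by a map `Y₁ → N` vanishing on boundaries. -/
def homologyOneDesc (l : Y.X 1 ⟶ N) (h : Y.d 2 1 ≫ l = 0) : Y.homology 1 ⟶ N :=
  Y.homologyι 1 ≫ Y.descOpcycles l 2 (by simp) h

theorem homologyOneDesc_comp (l : Y.X 1 ⟶ N) (h : Y.d 2 1 ≫ l = 0) (g : N ⟶ N') :
    homologyOneDesc l h ≫ g = homologyOneDesc (l ≫ g) (by rw [reassoc_of% h, zero_comp]) := by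
  simp only [homologyOneDesc, Category.assoc, HomologicalComplex.descOpcycles_comp]

theorem homologyMap_comp_homologyOneDesc (φ : Y ⟶ Y') (l : Y'.X 1 ⟶ N) (h : Y'.d 2 1 ≫ l = 0) :
    HomologicalComplex.homologyMap φ 1 ≫ homologyOneDesc l h =
      homologyOneDesc (φ.f 1 ≫ l) (by rw [← φ.comm_assoc, h, comp_zero]) := by
  simp only [homologyOneDesc, HomologicalComplex.homologyι_naturality_assoc,
    HomologicalComplex.opcyclesMap_comp_descOpcycles]

theorem homologyOneDesc_eq_of_homotopy (l l' : Y.X 1 ⟶ N) (h : Y.d 2 1 ≫ l = 0)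
    (h' : Y.d 2 1 ≫ l' = 0) (t : Y.X 0 ⟶ N) (ht : l = l' + Y.d 1 0 ≫ t) :
    homologyOneDesc l h = homologyOneDesc l' h' := by
  rw [← sub_eq_zero, homologyOneDesc, homologyOneDesc, ← Preadditive.comp_sub]
  refine Eq.trans ?_ (Y.homologyι_descOpcycles_eq_zero_of_boundary (i := 1)
    (Y.d 1 0 ≫ t) 2 (by simp) (i' := 0) t rfl)
  congr 1
  rw [← cancel_epi (Y.pOpcycles 1)]
  simp only [Preadditive.comp_sub, HomologicalComplex.p_descOpcycles]
  rw [ht, add_sub_cancel_left]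

end

variable {A : Type*} [Ring A] (T : C ⥤ ModuleCat.{v} A) [T.Additive]

/-- The complex obtained by applying `T` termwise. -/
abbrev mapComplex (X : ChainComplex C ℕ) : ChainComplex (ModuleCat.{v} A) ℕ :=
  (T.mapHomologicalComplex (ComplexShape.down ℕ)).obj X

variable {X Y : ChainComplex C ℕ} {K L : C}

/-- `T κ` as a map out of the complex `T X`. -/
def mapFrom {i : ℕ} (κ : X.X i ⟶ K) : (mapComplex T X).X i ⟶ T.obj K := T.map κ

theorem d_comp_mapFrom {i j : ℕ} (κ : X.X i ⟶ K) :
    (mapComplex T X).d j i ≫ mapFrom T κ = mapFrom T (X.d j i ≫ κ) :=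
  (T.map_comp _ _).symm

theorem mapFrom_comp {i : ℕ} (κ : X.X i ⟶ K) (g : K ⟶ L) :
    mapFrom T κ ≫ T.map g = mapFrom T (κ ≫ g) :=
  (T.map_comp _ _).symm

theorem map_f_comp_mapFrom {i : ℕ} (φ : X ⟶ Y) (κ : Y.X i ⟶ K) :
    ((T.mapHomologicalComplex (ComplexShape.down ℕ)).map φ).f i ≫ mapFrom T κ =
      mapFrom T (φ.f i ≫ κ) :=
  (T.map_comp _ _).symm

theorem mapFrom_zero {i : ℕ} : mapFrom T (0 : X.X i ⟶ K) = 0 :=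
  T.map_zero _ _

theorem mapFrom_add {i : ℕ} (κ κ' : X.X i ⟶ K) :
    mapFrom T (κ + κ') = mapFrom T κ + mapFrom T κ' :=
  T.map_add

/-- The map `H₁(T X) → T K` induced by a map `X₁ → K` vanishing on boundaries. -/
def mapHomologyDesc (κ : X.X 1 ⟶ K) (hκ : X.d 2 1 ≫ κ = 0) :
    (mapComplex T X).homology 1 ⟶ T.obj K :=
  homologyOneDesc (mapFrom T κ) (by rw [d_comp_mapFrom, hκ, mapFrom_zero])

theorem mapHomologyDesc_zero : mapHomologyDesc T (0 : X.X 1 ⟶ K) comp_zero = 0 := by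
  have : (mapComplex T X).descOpcycles (mapFrom T (0 : X.X 1 ⟶ K)) 2 (by simp)
      (by rw [d_comp_mapFrom, comp_zero, mapFrom_zero]) = 0 := by
    rw [← cancel_epi ((mapComplex T X).pOpcycles 1), HomologicalComplex.p_descOpcycles,
      mapFrom_zero, comp_zero]
  rw [mapHomologyDesc, homologyOneDesc, this, comp_zero]

theorem mapHomologyDesc_comp (κ : X.X 1 ⟶ K) (hκ : X.d 2 1 ≫ κ = 0) (g : K ⟶ L) :
    mapHomologyDesc T κ hκ ≫ T.map g =
      mapHomologyDesc T (κ ≫ g) (by rw [reassoc_of% hκ, zero_comp]) := by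
  simp only [mapHomologyDesc, homologyOneDesc_comp, mapFrom_comp]

theorem homologyMap_comp_mapHomologyDesc (φ : X ⟶ Y) (κ : Y.X 1 ⟶ K)
    (hκ : Y.d 2 1 ≫ κ = 0) :
    HomologicalComplex.homologyMap
        ((T.mapHomologicalComplex (ComplexShape.down ℕ)).map φ) 1 ≫ mapHomologyDesc T κ hκ =
      mapHomologyDesc T (φ.f 1 ≫ κ) (by rw [← φ.comm_assoc, hκ, comp_zero]) := by
  simp only [mapHomologyDesc, homologyMap_comp_homologyOneDesc, map_f_comp_mapFrom]

theorem mapHomologyDesc_eq_of_homotopy (κ κ' : X.X 1 ⟶ K) (hκ : X.d 2 1 ≫ κ = 0)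
    (hκ' : X.d 2 1 ≫ κ' = 0) (t : X.X 0 ⟶ K) (ht : κ = κ' + X.d 1 0 ≫ t) :
    mapHomologyDesc T κ hκ = mapHomologyDesc T κ' hκ' :=
  homologyOneDesc_eq_of_homotopy _ _ _ _ (mapFrom T t) (by
    rw [d_comp_mapFrom, ← mapFrom_add, ht])

variable [PreservesFiniteColimits T]

theorem exact_map_pOpcycles (i j : ℕ) (hij : j = i + 1) (y : T.obj (X.X i))
    (hy : T.map (X.pOpcycles i) y = 0) : ∃ x, T.map (X.d j i) x = y := by
  have h : (ShortComplex.mk (X.d j i) (X.pOpcycles i) (by simp)).Exact :=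
    ShortComplex.exact_of_g_is_cokernel _ (X.opcyclesIsCokernel j i (by simp [hij]))
  exact (ShortComplex.moduleCat_exact_iff _).1
    (h.map_of_epi_of_preservesCokernel T (inferInstanceAs (Epi (X.pOpcycles i)))
      inferInstance) y hy

/-- The comparison map from the opcycles of `T X` to `T` of the opcycles of `X`. -/
def opcyclesComparison (X : ChainComplex C ℕ) (i : ℕ) :
    (mapComplex T X).opcycles i ⟶ T.obj (X.opcycles i) :=
  (mapComplex T X).descOpcycles (mapFrom T (X.pOpcycles i)) (i + 1) (by simp) (by
    rw [d_comp_mapFrom, HomologicalComplex.d_pOpcycles, mapFrom_zero])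

omit [PreservesFiniteColimits T] in
theorem pOpcycles_comp_opcyclesComparison (i : ℕ) :
    (mapComplex T X).pOpcycles i ≫ opcyclesComparison T X i = mapFrom T (X.pOpcycles i) :=
  HomologicalComplex.p_descOpcycles _ _ _ _ _

/-- `T κ` as a map into the complex `T X`. -/
def mapTo {i : ℕ} (κ : K ⟶ X.X i) : T.obj K ⟶ (mapComplex T X).X i := T.map κ

omit [PreservesFiniteColimits T] in
theorem mapFrom_comp_mapTo {i j : ℕ} (κ : X.X i ⟶ K) (l : K ⟶ Y.X j) :
    mapFrom T κ ≫ mapTo T l = T.map (κ ≫ l) :=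
  (T.map_comp _ _).symm

omit [PreservesFiniteColimits T] in
theorem opcyclesComparison_comp (i j : ℕ) :
    opcyclesComparison T X i ≫ mapTo T (X.fromOpcycles i j) =
      (mapComplex T X).fromOpcycles i j := by
  rw [← cancel_epi ((mapComplex T X).pOpcycles i), ← Category.assoc,
    pOpcycles_comp_opcyclesComparison, HomologicalComplex.p_fromOpcycles]
  refine (mapFrom_comp_mapTo T _ _).trans ?_
  rw [HomologicalComplex.p_fromOpcycles]
  rfl

instance (i : ℕ) : IsIso (opcyclesComparison T X i) := by
  have hp : Epi (mapFrom T (X.pOpcycles i)) := inferInstanceAs (Epi (T.map (X.pOpcycles i)))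
  have : Epi (opcyclesComparison T X i) :=
    epi_of_epi_fac (pOpcycles_comp_opcyclesComparison T i)
  have : Mono (opcyclesComparison T X i) := by
    refine mono_of_injective_zero _ fun x hx => ?_
    obtain ⟨y, rfl⟩ := (ModuleCat.epi_iff_surjective ((mapComplex T X).pOpcycles i)).1
      inferInstance x
    rw [← ConcreteCategory.comp_apply, pOpcycles_comp_opcyclesComparison] at hx
    obtain ⟨z, rfl⟩ := exact_map_pOpcycles T i (i + 1) rfl y hx
    exact congrArg (fun g => g.hom z) ((mapComplex T X).d_pOpcycles (i + 1) i)
  exact isIso_of_mono_of_epi _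

omit [PreservesFiniteColimits T] in
theorem mapHomologyDesc_pOpcycles :
    mapHomologyDesc T (X.pOpcycles 1) (by simp) =
      (mapComplex T X).homologyι 1 ≫ opcyclesComparison T X 1 := rfl

instance : Mono (mapHomologyDesc T (X.pOpcycles 1) (by simp)) := by
  rw [mapHomologyDesc_pOpcycles]
  exact mono_comp _ _

/-- `H₁(T X)` is the kernel of `T` applied to `coker (X₂ → X₁) → X₀`. -/
theorem mapHomologyDesc_pOpcycles_exact (y : T.obj (X.opcycles 1))
    (hy : T.map (X.fromOpcycles 1 0) y = 0) :
    ∃ x, mapHomologyDesc T (X.pOpcycles 1) (by simp) x = y := by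
  obtain ⟨z, rfl⟩ := (ModuleCat.epi_iff_surjective (opcyclesComparison T X 1)).1
      inferInstance y
  have h : (ShortComplex.mk _ _ ((mapComplex T X).homologyι_comp_fromOpcycles 1 0)).Exact :=
    ShortComplex.exact_of_f_is_kernel _ ((mapComplex T X).homologyIsKernel 1 0 (by simp))
  obtain ⟨x, hx⟩ := (ShortComplex.moduleCat_exact_iff _).1 h z
    ((congrArg (fun g => g.hom z) (opcyclesComparison_comp T 1 0)).symm.trans hy)
  exact ⟨x, congrArg (opcyclesComparison T X 1).hom hx⟩

/-- T commutes with opcycles, so the kernel of this map is the homology of T X in degree n + 1. -/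
theorem mono_map_fromOpcycles_iff (n : ℕ) :
    Mono (T.map (X.fromOpcycles (n + 1) n)) ↔ IsZero ((mapComplex T X).homology (n + 1)) := by
  have e := opcyclesComparison_comp T (X := X) (n + 1) n
  have h1 : Mono (T.map (X.fromOpcycles (n + 1) n)) ↔
      Mono ((mapComplex T X).fromOpcycles (n + 1) n) := by
    rw [← e]
    constructor
    · intro h
      have : Mono (mapTo T (X.fromOpcycles (n + 1) n)) := h
      exact mono_comp _ _
    · intro h
      have h' : mapTo T (X.fromOpcycles (n + 1) n) =
        inv (opcyclesComparison T X (n + 1)) ≫ opcyclesComparison T X (n + 1) ≫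
          mapTo T (X.fromOpcycles (n + 1) n) := by simp
      have : Mono (mapTo T (X.fromOpcycles (n + 1) n)) := by
        rw [h']
        exact mono_comp _ _
      exact this
  rw [h1]
  have hk := (mapComplex T X).homologyIsKernel (n + 1) n (by simp)
  constructor
  · intro h
    rw [IsZero.iff_id_eq_zero, ← cancel_mono ((mapComplex T X).homologyι (n + 1)),
      ← cancel_mono ((mapComplex T X).fromOpcycles (n + 1) n)]
    simp
  · intro hz
    refine Preadditive.mono_of_cancel_zero _ fun g hg => ?_
    obtain ⟨l, hl⟩ := KernelFork.IsLimit.lift' hk g hg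
    rw [← hl, hz.eq_of_tgt l 0, zero_comp]

variable [HasProjectiveResolutions C]

theorem isTAcyclic_iff_isZero_leftDerived {M : C} :
    IsTAcyclic T M ↔ IsZero ((T.leftDerived 1).obj M) := by
  have P := projectiveResolution M
  rw [(P.isoLeftDerivedObj T 1).isZero_iff]
  refine Iff.trans ?_ (mono_map_fromOpcycles_iff T (X := P.complex) 0)
  constructor
  · intro h
    exact h _ _ _ (shortExact_fromOpcycles_zero P)
  · intro h
    exact IsTAcyclic.of_mono (shortExact_fromOpcycles_zero P) (isTAcyclic_of_projective _) h

/-- A short exact sequence with projective third term splits. -/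
def splittingOfProjectiveThird {S : ShortComplex C} (hS : S.ShortExact) [Projective S.X₃] :
    S.Splitting :=
  hS.splittingOfProjective

/-- Let E be the pullback of N → Q ← P₀. It is an extension of N by the first syzygy of Q, which is
acyclic because L₂T Q = 0; so E is acyclic. It is also an extension of the projective P₀ by M, so M
is a retract of E. -/
theorem IsTAcyclic.of_isZero_leftDerived_two {M N Q : C} {i : M ⟶ N} {p : N ⟶ Q} {w : i ≫ p = 0}
    (hS : (ShortComplex.mk i p w).ShortExact) (hN : IsTAcyclic T N)
    (hQ : IsZero ((T.leftDerived 2).obj Q)) : IsTAcyclic T M := by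
  have P := projectiveResolution Q
  have hP : IsTAcyclic T (P.complex.opcycles 1) := by
    refine IsTAcyclic.of_mono (shortExact_fromOpcycles_one P) (isTAcyclic_of_projective _) ?_
    exact (mono_map_fromOpcycles_iff T (X := P.complex) 1).2
      ((P.isoLeftDerivedObj T 2).isZero_iff.1 hQ)
  have sq : IsPullback (pullback.fst p (augmentation P)) (pullback.snd p (augmentation P)) p _ :=
    IsPullback.of_hasPullback _ _
  have h1 := shortExact_lift_of_isPullback hS sq
  have h2 := shortExact_lift_of_isPullback (shortExact_fromOpcycles_zero P) sq.flip
  have hE := IsTAcyclic.extension h2 hP hN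
  let s := splittingOfProjectiveThird h1
  exact hE.retract _ s.r s.f_r

end Derived

/-! ### The connecting map L₁T M → T K. -/

section Connecting

variable {C : Type*} [Category* C] [Abelian C]

/-- Data describing the connecting map `L₁T(M) → T K` of `0 → K → B → M → 0` in terms of a
projective resolution of `M`. -/
structure ConnectingData {M K B : C} (P : ProjectiveResolution M) (i : K ⟶ B) (p : B ⟶ M) where
  /-- a lift of the augmentation -/
  lift : P.complex.X 0 ⟶ B
  lift_comp : lift ≫ p = augmentation P
  /-- the induced map to the kernel -/
  desc : P.complex.X 1 ⟶ K
  desc_comp : desc ≫ i = P.complex.d 1 0 ≫ lift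

theorem ConnectingData.d_comp_desc {M K B : C} {P : ProjectiveResolution M} {i : K ⟶ B}
    {p : B ⟶ M} (c : ConnectingData P i p) [Mono i] : P.complex.d 2 1 ≫ c.desc = 0 := by
  rw [← cancel_mono i, Category.assoc, c.desc_comp, HomologicalComplex.d_comp_d_assoc,
    zero_comp, zero_comp]

/-- Connecting data obtained from the lifting property. -/
def connectingData {M K B : C} (P : ProjectiveResolution M) {i : K ⟶ B} {p : B ⟶ M}
    {w : i ≫ p = 0} (hS : (ShortComplex.mk i p w).ShortExact) : ConnectingData P i p :=
  have : Epi p := hS.epi_g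
  have : Mono i := hS.mono_f
  have e : Projective.factorThru (augmentation P) p ≫ p = augmentation P :=
    Projective.factorThru_comp _ _
  have h : (P.complex.d 1 0 ≫ Projective.factorThru (augmentation P) p) ≫ p = 0 := by
    rw [Category.assoc, e, d_comp_augmentation]
  { lift := Projective.factorThru (augmentation P) p
    lift_comp := e
    desc := hS.exact.lift _ h
    desc_comp := hS.exact.lift_f _ h }

/-- The two ways round the square lift the same map P₀ → M' to B', so they differ by some t : P₀ →
K'. This correction vanishes on H₁. -/
theorem ConnectingData.naturality {M K B M' K' B' : C} {P : ProjectiveResolution M} {i : K ⟶ B}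
    {p : B ⟶ M} [Mono i] (c : ConnectingData P i p) {P' : ProjectiveResolution M'} {i' : K' ⟶ B'}
    {p' : B' ⟶ M'} {w' : i' ≫ p' = 0} (hS' : (ShortComplex.mk i' p' w').ShortExact) [Mono i']
    (c' : ConnectingData P' i' p') (k : K ⟶ K') (b : B ⟶ B') (m : M ⟶ M')
    (h₁ : i ≫ b = k ≫ i') (h₂ : p ≫ m = b ≫ p') (φ : P.complex ⟶ P'.complex)
    (hφ : φ.f 0 ≫ augmentation P' = augmentation P ≫ m) :
    ∃ t, c.desc ≫ k = φ.f 1 ≫ c'.desc + P.complex.d 1 0 ≫ t := by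
  have h : (c.lift ≫ b - φ.f 0 ≫ c'.lift) ≫ p' = 0 := by
    rw [Preadditive.sub_comp, Category.assoc, Category.assoc, c'.lift_comp, ← h₂,
      ← Category.assoc, c.lift_comp, hφ, sub_self]
  obtain ⟨t, ht⟩ := hS'.exact.lift' _ h
  refine ⟨t, ?_⟩
  dsimp at ht
  rw [← cancel_mono i', Preadditive.add_comp, Category.assoc, Category.assoc, Category.assoc,
    c'.desc_comp, ht, ← h₁, ← Category.assoc, c.desc_comp, Preadditive.comp_sub, φ.comm_assoc]
  simp

variable [HasProjectiveResolutions C] {A : Type*} [Ring A] (T : C ⥤ ModuleCat.{v} A) [T.Additive]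

/-- `L₁T(M)` computed by a projective resolution. -/
def leftDerivedOneIso {M : C} (P : ProjectiveResolution M) :
    (T.leftDerived 1).obj M ≅ (mapComplex T P.complex).homology 1 :=
  P.isoLeftDerivedObj T 1

theorem leftDerivedOneIso_naturality {M M' : C} (P : ProjectiveResolution M)
    (P' : ProjectiveResolution M') (m : M ⟶ M') (φ : P.complex ⟶ P'.complex)
    (hφ : φ.f 0 ≫ augmentation P' = augmentation P ≫ m) :
    (T.leftDerived 1).map m ≫ (leftDerivedOneIso T P').hom =
      (leftDerivedOneIso T P).hom ≫ HomologicalComplex.homologyMap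
        ((T.mapHomologicalComplex (ComplexShape.down ℕ)).map φ) 1 :=
  ProjectiveResolution.isoLeftDerivedObj_hom_naturality m P P' φ hφ T 1

/-- The connecting map `L₁T(M) → T K` of a short exact sequence `0 → K → B → M → 0`. -/
def connecting {M K B : C} {i : K ⟶ B} {p : B ⟶ M} {w : i ≫ p = 0}
    (hS : (ShortComplex.mk i p w).ShortExact) : (T.leftDerived 1).obj M ⟶ T.obj K :=
  (leftDerivedOneIso T (projectiveResolution M)).hom ≫
    mapHomologyDesc T (connectingData (projectiveResolution M) hS).desc
      (have : Mono i := hS.mono_f; ConnectingData.d_comp_desc _)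

theorem connecting_naturality {M K B M' K' B' : C} {i : K ⟶ B} {p : B ⟶ M} {w : i ≫ p = 0}
    (hS : (ShortComplex.mk i p w).ShortExact) {i' : K' ⟶ B'} {p' : B' ⟶ M'} {w' : i' ≫ p' = 0}
    (hS' : (ShortComplex.mk i' p' w').ShortExact) (k : K ⟶ K') (b : B ⟶ B') (m : M ⟶ M')
    (h₁ : i ≫ b = k ≫ i') (h₂ : p ≫ m = b ≫ p') :
    (T.leftDerived 1).map m ≫ connecting T hS' = connecting T hS ≫ T.map k := by
  have : Mono i := hS.mono_f
  have : Mono i' := hS'.mono_f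
  let P := projectiveResolution M
  let P' := projectiveResolution M'
  let φ := ProjectiveResolution.lift m P P'
  have hφ : φ.f 0 ≫ augmentation P' = augmentation P ≫ m := lift_comp_augmentation m P P'
  obtain ⟨t, ht⟩ := (connectingData P hS).naturality hS' (connectingData P' hS') k b m h₁ h₂ φ hφ
  rw [connecting, connecting, Category.assoc, mapHomologyDesc_comp, ← Category.assoc,
    leftDerivedOneIso_naturality T P P' m φ hφ, Category.assoc, homologyMap_comp_mapHomologyDesc]
  congr 1
  exact (mapHomologyDesc_eq_of_homotopy T _ _ _ _ t ht).symm

/-- The tautological connecting data. -/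
def opcyclesConnectingData {M : C} (P : ProjectiveResolution M) :
    ConnectingData P (P.complex.fromOpcycles 1 0) (augmentation P) where
  lift := 𝟙 _
  lift_comp := Category.id_comp _
  desc := P.complex.pOpcycles 1
  desc_comp := by simp

variable [PreservesFiniteColimits T]

section

variable {M K B : C} [Projective B] {i : K ⟶ B} {p : B ⟶ M} {w : i ≫ p = 0}
    (hS : (ShortComplex.mk i p w).ShortExact)

include hS

omit [HasProjectiveResolutions C] in
-- Schanuel's comparison of two syzygies of M: they agree up to maps through the projectives B and
-- P₀. After T, the correction i ≫ s dies on ker (T i) and d ≫ t dies on H₁, so H₁ is identified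
-- with ker (T i).
theorem exists_map_opcycles (P : ProjectiveResolution M) (c : ConnectingData P i p) :
    ∃ (k : K ⟶ P.complex.opcycles 1) (k' : P.complex.opcycles 1 ⟶ K) (s : B ⟶ K)
      (t : P.complex.X 0 ⟶ P.complex.opcycles 1) (b : B ⟶ P.complex.X 0),
      P.complex.pOpcycles 1 ≫ k' = c.desc ∧ k ≫ k' = 𝟙 K + i ≫ s ∧
      c.desc ≫ k = P.complex.pOpcycles 1 + P.complex.d 1 0 ≫ t ∧
      k ≫ P.complex.fromOpcycles 1 0 = i ≫ b := by
  have : Mono i := hS.mono_f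
  have hP := shortExact_fromOpcycles_zero P
  have : Mono (P.complex.fromOpcycles 1 0) := hP.mono_f
  let b := Projective.factorThru p (augmentation P)
  have hb : b ≫ augmentation P = p := Projective.factorThru_comp _ _
  obtain ⟨k, hk⟩ := hP.exact.lift' (i ≫ b) (by dsimp; rw [Category.assoc, hb, w])
  dsimp at hk
  let k' := P.complex.descOpcycles c.desc 2 (by simp) c.d_comp_desc
  have hk' : P.complex.pOpcycles 1 ≫ k' = c.desc := P.complex.p_descOpcycles _ _ _ _
  obtain ⟨t, ht⟩ := c.naturality hP (opcyclesConnectingData P) k b (𝟙 M) hk.symm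
    (by rw [hb, Category.comp_id]) (𝟙 _) (by simp)
  obtain ⟨s, hs⟩ := hS.exact.lift' (b ≫ c.lift - 𝟙 B) (by
    dsimp
    rw [Preadditive.sub_comp, Category.assoc, c.lift_comp, hb, Category.id_comp, sub_self])
  dsimp at hs
  have hk'' : k' ≫ i = P.complex.fromOpcycles 1 0 ≫ c.lift := by
    rw [← cancel_epi (P.complex.pOpcycles 1), reassoc_of% hk', c.desc_comp]
    simp
  refine ⟨k, k', s, t, b, hk', ?_, ?_, hk⟩
  · rw [← cancel_mono i, Category.assoc, hk'', reassoc_of% hk, Preadditive.add_comp,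
      Category.assoc, hs, Preadditive.comp_sub]
    simp
  · simpa [opcyclesConnectingData] using ht

theorem mono_connecting : Mono (connecting T hS) := by
  let P := projectiveResolution M
  obtain ⟨k, k', s, t, b, h1, h2, h3, h4⟩ := exists_map_opcycles hS P (connectingData P hS)
  have : Mono i := hS.mono_f
  have h : mapHomologyDesc T (connectingData P hS).desc (ConnectingData.d_comp_desc _) ≫ T.map k =
      mapHomologyDesc T (P.complex.pOpcycles 1) (by simp) := by
    rw [mapHomologyDesc_comp]
    exact mapHomologyDesc_eq_of_homotopy T _ _ _ _ t h3
  have : Mono (mapHomologyDesc T (connectingData P hS).desc (ConnectingData.d_comp_desc _)) :=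
    mono_of_mono_fac h
  exact mono_comp _ _

theorem connecting_exact (y : T.obj K) (hy : T.map i y = 0) :
    ∃ x, connecting T hS x = y := by
  let P := projectiveResolution M
  obtain ⟨k, k', s, t, b, h1, h2, h3, h4⟩ := exists_map_opcycles hS P (connectingData P hS)
  have : Mono i := hS.mono_f
  obtain ⟨x, hx⟩ := mapHomologyDesc_pOpcycles_exact T (X := P.complex) (T.map k y) (by
    rw [← ConcreteCategory.comp_apply, ← T.map_comp, h4, T.map_comp, ConcreteCategory.comp_apply,
      hy, map_zero])
  refine ⟨(leftDerivedOneIso T P).inv x, ?_⟩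
  have e : (leftDerivedOneIso T P).inv ≫ connecting T hS =
      mapHomologyDesc T (P.complex.pOpcycles 1) (by simp) ≫ T.map k' := by
    rw [connecting, Iso.inv_hom_id_assoc, mapHomologyDesc_comp]
    simp only [h1]
    rfl
  rw [← ConcreteCategory.comp_apply, e, ConcreteCategory.comp_apply, hx,
    ← ConcreteCategory.comp_apply, ← T.map_comp, h2, T.map_add, T.map_id, T.map_comp]
  refine (congrArg (y + ·) (congrArg (T.map s) hy)).trans ?_
  rw [map_zero, add_zero]

omit [PreservesFiniteColimits T] [Projective B] in
theorem connecting_comp : connecting T hS ≫ T.map i = 0 := by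
  have : Mono i := hS.mono_f
  rw [connecting, Category.assoc, mapHomologyDesc_comp]
  have := mapHomologyDesc_eq_of_homotopy T
    ((connectingData (projectiveResolution M) hS).desc ≫ i) 0
    (by rw [← Category.assoc, ConnectingData.d_comp_desc, zero_comp]) comp_zero _
    (by rw [zero_add]; exact (connectingData (projectiveResolution M) hS).desc_comp)
  rw [this, mapHomologyDesc_zero, comp_zero]

end

end Connecting

theorem mono_of_isIso_square {C : Type*} [Category* C] {X Y X' Y' : C} {g : X ⟶ Y} {g' : X' ⟶ Y'}
    {a : X ⟶ X'} {b : Y ⟶ Y'} (hg : Mono g) (_ : IsIso a) (_ : IsIso b) (h : g ≫ b = a ≫ g') :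
    Mono g' := by
  rw [← IsIso.inv_comp_eq] at h
  rw [← h]
  infer_instance

/-! ### Independence of the acting ring. -/

section ChangeOfAction

variable (R : Type u) [Ring R] (A : Type*) [Ring A]
  (N : Type u) [AddCommGroup N] [Module R N] [Module A N] [SMulCommClass R A N]

/-- The hypothesis on w.gl.dim concerns Tor as an abelian group, 𝒳₀ concerns Tor as an S-module.
Acyclicity only involves injectivity, and the balancing relations span the same subgroup for every
`A`. -/
theorem injective_balancedMap_iff {M M' : Type u} [AddCommGroup M] [Module Rᵐᵒᵖ M]
    [AddCommGroup M'] [Module Rᵐᵒᵖ M'] (g : M →ₗ[Rᵐᵒᵖ] M') :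
    Function.Injective (balancedMap R A N g) ↔ Function.Injective (balancedMap R ℤ N g) := by
  have key : ∀ (M : Type u) [AddCommGroup M] [Module Rᵐᵒᵖ M] (x : N ⊗[ℤ] M),
      x ∈ balancedRel R A N M ↔ x ∈ balancedRel R ℤ N M := by
    intro M _ _ x
    rw [← Submodule.mem_toAddSubgroup, balancedRel_toAddSubgroup,
      ← balancedRel_toAddSubgroup R ℤ N M, Submodule.mem_toAddSubgroup]
  rw [injective_iff_map_eq_zero, injective_iff_map_eq_zero]
  constructor
  · intro h x
    obtain ⟨y, rfl⟩ := Submodule.mkQ_surjective _ x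
    intro hx
    have h1 := (Submodule.Quotient.mk_eq_zero _).1 hx
    have h2 := h ((balancedRel R A N M).mkQ y)
      ((Submodule.Quotient.mk_eq_zero _).2 ((key M' _).2 h1))
    exact (Submodule.Quotient.mk_eq_zero _).2 ((key M _).1 ((Submodule.Quotient.mk_eq_zero _).1 h2))
  · intro h x
    obtain ⟨y, rfl⟩ := Submodule.mkQ_surjective _ x
    intro hx
    have h1 := (Submodule.Quotient.mk_eq_zero _).1 hx
    have h2 := h ((balancedRel R ℤ N M).mkQ y)
      ((Submodule.Quotient.mk_eq_zero _).2 ((key M' _).1 h1))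
    exact (Submodule.Quotient.mk_eq_zero _).2 ((key M _).2 ((Submodule.Quotient.mk_eq_zero _).1 h2))

theorem mono_tensorFunctor_map_iff {M M' : ModuleCat.{u} Rᵐᵒᵖ} (g : M ⟶ M') :
    Mono ((tensorFunctor R A N).map g) ↔ Mono ((tensorFunctor R ℤ N).map g) := by
  rw [ModuleCat.mono_iff_injective, ModuleCat.mono_iff_injective]
  exact injective_balancedMap_iff R A N g.hom

theorem isTAcyclic_tensorFunctor_iff (M : ModuleCat.{u} Rᵐᵒᵖ) :
    IsTAcyclic (tensorFunctor R A N) M ↔ IsTAcyclic (tensorFunctor R ℤ N) M := by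
  simp only [IsTAcyclic, mono_tensorFunctor_map_iff R A N]

end ChangeOfAction

/-! ### Tor-acyclic modules. -/

section

variable {R S : Type u} [Ring R] [Ring S] (f : R →+* S)

/-- Modules `X` with `Tor_1^R(X, S) = 0`. -/
abbrev TorAcyclic (M : ModuleCat.{u} Rᵐᵒᵖ) : Prop := IsTAcyclic (tensorS f) M

theorem torAcyclic_iff (M : ModuleCat.{u} Rᵐᵒᵖ) :
    TorAcyclic f M ↔ IsZero ((torS f 1).obj M) :=
  isTAcyclic_iff_isZero_leftDerived _

theorem classX_iff (M : ModuleCat.{u} Rᵐᵒᵖ) :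
    classX f M ↔ IsZero ((tensorS f).obj M) ∧ TorAcyclic f M := by
  rw [torAcyclic_iff]; rfl

variable {f}

theorem TorAcyclic.of_shortExact (hR : WeakGlobalDimLEOne R) {M N Q : ModuleCat.{u} Rᵐᵒᵖ}
    {i : M ⟶ N} {p : N ⟶ Q} {w : i ≫ p = 0} (hS : (ShortComplex.mk i p w).ShortExact)
    (hN : TorAcyclic f N) : TorAcyclic f M := by
  refine (isTAcyclic_tensorFunctor_iff R Sᵐᵒᵖ (AsBimodule f) M).2 ?_
  exact IsTAcyclic.of_isZero_leftDerived_two (tensorFunctor R ℤ (AsBimodule f)) hS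
    ((isTAcyclic_tensorFunctor_iff R Sᵐᵒᵖ (AsBimodule f) N).1 hN)
    (hR Q (ModuleCat.of R (AsBimodule f)))

theorem TorAcyclic.of_mono (hR : WeakGlobalDimLEOne R) {M N : ModuleCat.{u} Rᵐᵒᵖ}
    (i : M ⟶ N) [Mono i] (hN : TorAcyclic f N) : TorAcyclic f M :=
  TorAcyclic.of_shortExact hR (i := i) (p := cokernel.π i) (w := cokernel.condition i)
    { exact := ShortComplex.exact_cokernel i } hN

instance : (restrict f).IsLeftAdjoint :=
  (ModuleCat.restrictCoextendScalarsAdj.{u} (RingHom.op f)).isLeftAdjoint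

instance : PreservesFiniteLimits (restrict f) :=
  have : PreservesLimitsOfSize.{0, 0} (restrict f) :=
    (tensorRestrictAdj f).rightAdjoint_preservesLimits
  PreservesLimitsOfSize.preservesFiniteLimits (restrict f)

theorem mono_restrict_map_iff {M N : ModuleCat.{u} Sᵐᵒᵖ} (g : M ⟶ N) :
    Mono ((restrict f).map g) ↔ Mono g := by
  rw [ModuleCat.mono_iff_injective, ModuleCat.mono_iff_injective]
  rfl

/-- Coproducts of acyclic modules are acyclic. -/
theorem IsTAcyclic.coproduct {A B : Type u} [Ring A] [Ring B]
    (T : ModuleCat.{u} B ⥤ ModuleCat.{u} A) [T.Additive] [T.IsLeftAdjoint]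
    {ι : Type u} (M : ι → ModuleCat.{u} B) (hM : ∀ i, IsTAcyclic T (M i)) :
    IsTAcyclic T (∐ M) := by
  let P : ι → ModuleCat.{u} B := fun i => Projective.over (M i)
  let p : ∀ i, P i ⟶ M i := fun i => Projective.π (M i)
  have hp : ∀ i, Epi (p i) := fun i => inferInstanceAs (Epi (Projective.π (M i)))
  have hP : ∀ i, Projective (P i) := fun i => inferInstanceAs (Projective (Projective.over (M i)))
  have hP' : Projective (∐ P) := Projective.instSigmaObj P
  let K : ι → ModuleCat.{u} B := fun i => kernel (p i)
  let k : ∀ i, K i ⟶ P i := fun i => kernel.ι (p i)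
  have hk : ∀ i, Mono (k i) := fun i => inferInstanceAs (Mono (kernel.ι (p i)))
  have hS : ∀ i, (ShortComplex.mk (k i) (p i) (kernel.condition _)).ShortExact :=
    fun i => { exact := ShortComplex.exact_kernel _ }
  let a : ∐ K ⟶ ∐ P := Limits.Sigma.map k
  let b : ∐ P ⟶ ∐ M := Limits.Sigma.map p
  have ha : ∀ i, Sigma.ι K i ≫ a = k i ≫ Sigma.ι P i := fun i => Sigma.ι_map _ _
  have hb : ∀ i, Sigma.ι P i ≫ b = p i ≫ Sigma.ι M i := fun i => Sigma.ι_map _ _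
  have hab : a ≫ b = 0 := by
    ext i : 1
    rw [reassoc_of% ha i, hb i, comp_zero, ← Category.assoc]
    exact (congrArg (· ≫ Sigma.ι M i) (kernel.condition (p i))).trans zero_comp
  have hSab : (ShortComplex.mk a b hab).ShortExact :=
    { mono_f := inferInstanceAs (Mono (Limits.Sigma.map k))
      epi_g := inferInstanceAs (Epi (Limits.Sigma.map p))
      exact := ShortComplex.exact_of_g_is_cokernel _ (by
        refine CokernelCofork.IsColimit.ofπ' _ _ fun {W} l hl => ?_
        have h : ∀ i, k i ≫ Sigma.ι P i ≫ l = 0 := fun i => by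
          rw [← reassoc_of% ha i]
          exact (congrArg (Sigma.ι K i ≫ ·) hl).trans comp_zero
        refine ⟨Sigma.desc fun i => (hS i).exact.desc (Sigma.ι P i ≫ l) (h i), ?_⟩
        refine Sigma.hom_ext _ _ fun i => ?_
        rw [reassoc_of% hb i, Sigma.ι_desc]
        exact (hS i).exact.g_desc (Sigma.ι P i ≫ l) (h i)) }
  refine IsTAcyclic.of_mono hSab (isTAcyclic_of_projective _) ?_
  have h1 : ∀ i, Mono (T.map (k i)) := fun i => hM i _ _ _ (hS i)
  -- T commutes with coproducts, so T a is, up to isomorphism, the coproduct of the monos T (k i).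
  have h2 : (PreservesCoproduct.iso T K).inv ≫ T.map a =
      Limits.Sigma.map (fun i => T.map (k i)) ≫ (PreservesCoproduct.iso T P).inv := by
    refine Sigma.hom_ext _ _ fun i => ?_
    rw [PreservesCoproduct.inv_hom, ι_comp_sigmaComparison_assoc, ← T.map_comp, ha, T.map_comp,
      Limits.Sigma.ι_map_assoc, PreservesCoproduct.inv_hom, ι_comp_sigmaComparison]
  rw [Iso.inv_comp_eq] at h2
  rw [h2]
  have : Mono (Limits.Sigma.map fun i => T.map (k i)) := inferInstance
  exact mono_comp _ _

/-- Cover X by a coproduct of copies of S; it stays a coproduct over R, hence acyclic. The kernel is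
again an S-module, and on S-modules the unit is invertible, so tensoring the kernel inclusion with S
gives back a mono. -/
theorem torAcyclic_restrict [(restrict f).Full]
    (h : TorAcyclic f ((restrict f).obj (ModuleCat.of Sᵐᵒᵖ S))) (X : ModuleCat.{u} Sᵐᵒᵖ) :
    TorAcyclic f ((restrict f).obj X) := by
  have hF : TorAcyclic f ((restrict f).obj (∐ fun _ : X => ModuleCat.of Sᵐᵒᵖ S)) := by
    refine IsTAcyclic.of_iso ?_ (PreservesCoproduct.iso (restrict f) _).symm
    exact IsTAcyclic.coproduct _ _ fun _ => h
  let p : (∐ fun _ : X => ModuleCat.of Sᵐᵒᵖ S) ⟶ X := Sigma.desc fun x => ModuleCat.ofHom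
    (Y := X) { toFun := fun s => MulOpposite.op s • x
               map_add' := fun s s' => add_smul (MulOpposite.op s) (MulOpposite.op s') x
               map_smul' := fun a s => mul_smul a (MulOpposite.op s) x }
  have hp : Epi p := by
    rw [ModuleCat.epi_iff_surjective]
    intro x
    refine ⟨Sigma.ι (fun _ : X => ModuleCat.of Sᵐᵒᵖ S) x (1 : S), ?_⟩
    rw [← ConcreteCategory.comp_apply, Sigma.ι_desc]
    exact one_smul Sᵐᵒᵖ x
  have hS : (ShortComplex.mk (kernel.ι p) p (kernel.condition p)).ShortExact :=
    { exact := ShortComplex.exact_kernel p }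
  refine IsTAcyclic.of_mono (hS.map_of_exact (restrict f)) hF ?_
  have hk := (mono_restrict_map_iff (f := f) (kernel.ι p)).2 inferInstance
  have := mono_of_isIso_square hk
    (isIso_unitS_app f ((restrict f).obj_mem_essImage _))
    (isIso_unitS_app f ((restrict f).obj_mem_essImage _))
    ((unitS f).naturality ((restrict f).map (kernel.ι p)))
  exact (mono_restrict_map_iff _).1 this

end

/-! ### Vanishing of Hom and Ext¹ from 𝒳₀ to Mod-S. -/

section Orthogonal

variable {R S : Type u} [Ring R] [Ring S] {f : R →+* S} [(restrict f).Full]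

theorem hom_eq_zero {X N : ModuleCat.{u} Rᵐᵒᵖ} (hX : classX f X) (hN : classS f N)
    (g : X ⟶ N) : g = 0 := by
  have := isIso_unitS_app f hN
  have hz : (tensorS f).map g = 0 := hX.1.eq_of_src _ _
  have h := (unitS f).naturality g
  have h' : (tensorS f ⋙ restrict f).map g = 0 :=
    (congrArg (restrict f).map hz).trans ((restrict f).map_zero _ _)
  rw [h', comp_zero] at h
  exact (IsIso.mono_of_iso ((unitS f).app N)).right_cancellation g 0 (h.trans zero_comp.symm)

/-- Tensoring i with S gives a mono since Tor_1(X, S) = 0 and an epi since X ⊗ S = 0. The retraction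
is E → E ⊗ S ≅ N ⊗ S ≅ N. -/
theorem exists_retraction {N E X : ModuleCat.{u} Rᵐᵒᵖ} {i : N ⟶ E} {p : E ⟶ X} {w : i ≫ p = 0}
    (hS : (ShortComplex.mk i p w).ShortExact) (hN : classS f N) (hX : classX f X) :
    ∃ r : E ⟶ N, i ≫ r = 𝟙 N := by
  have hu := isIso_unitS_app f hN
  have h1 : Mono ((tensorS f).map i) := ((classX_iff f X).1 hX).2 _ _ _ hS
  have h2 : Epi ((tensorS f).map i) := by
    rw [ModuleCat.epi_iff_surjective]
    intro y
    exact exact_map hS y (congrArg (fun g => g.hom y)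
      (hX.1.eq_of_tgt ((tensorS f).map p) 0))
  have h3 : IsIso ((tensorS f).map i) := isIso_of_mono_of_epi _
  have h4 : IsIso ((tensorS f ⋙ restrict f).map i) :=
    inferInstanceAs (IsIso ((restrict f).map ((tensorS f).map i)))
  have hn : i ≫ (unitS f).app E = (unitS f).app N ≫ (tensorS f ⋙ restrict f).map i :=
    (unitS f).naturality i
  refine ⟨(unitS f).app E ≫ inv ((tensorS f ⋙ restrict f).map i) ≫ inv ((unitS f).app N), ?_⟩
  rw [← Category.assoc, hn, Category.assoc, IsIso.hom_inv_id_assoc, IsIso.hom_inv_id]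

end Orthogonal

/-! ### Coreflections and reflections from orthogonality. -/

section FiveTerm

variable {C : Type*} [Category* C] [Abelian C] {P Q : ObjectProperty C}

/-- In a five-term exact sequence with terms in `Q, P, -, Q, P`, where `Hom` and `Ext¹` from `P`
to `Q` vanish, the second map is a `P`-coreflection. -/
theorem isCoreflection_of_exact
    (hom : ∀ {X N : C}, P X → Q N → ∀ g : X ⟶ N, g = 0)
    (ext : ∀ {N E X : C} {i : N ⟶ E} {p : E ⟶ X} {w : i ≫ p = 0},
      (ShortComplex.mk i p w).ShortExact → Q N → P X → ∃ r : E ⟶ N, i ≫ r = 𝟙 N)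
    {E₀ E₁ E₂ E₃ : C} {a : E₀ ⟶ E₁} {b : E₁ ⟶ E₂} {c : E₂ ⟶ E₃} (ha : Mono a)
    {wab : a ≫ b = 0} (hab : (ShortComplex.mk a b wab).Exact)
    {wbc : b ≫ c = 0} (hbc : (ShortComplex.mk b c wbc).Exact)
    (h₀ : Q E₀) (h₁ : P E₁) (h₃ : Q E₃) : IsCoreflection P b := by
  refine ⟨h₁, fun X hX g => ?_⟩
  have huniq : ∀ h : X ⟶ E₁, h ≫ b = 0 → h = 0 := fun h hh => by
    obtain ⟨l, hl⟩ := hab.lift' h hh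
    rw [← hl, hom hX h₀ l, zero_comp]
  suffices ∃ h, h ≫ b = g by
    obtain ⟨h, hh⟩ := this
    refine ⟨h, hh, fun h' hh' => ?_⟩
    rw [← sub_eq_zero]
    exact huniq _ (by rw [Preadditive.sub_comp, hh, hh', sub_self])
  let e : E₁ ⟶ kernel c := kernel.lift c b wbc
  have he : e ≫ kernel.ι c = b := kernel.lift_ι _ _ _
  have hepi : Epi e := hbc.epi_kernelLift
  have hae : a ≫ e = 0 := by
    rw [← cancel_mono (kernel.ι c), Category.assoc, he, wab, zero_comp]
  have hS : (ShortComplex.mk a e hae).ShortExact :=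
    { mono_f := ha
      epi_g := hepi
      exact := (ShortComplex.exact_iff_of_epi_of_isIso_of_mono
        (S₁ := ShortComplex.mk a e hae) (S₂ := ShortComplex.mk a b wab)
        { τ₁ := 𝟙 _, τ₂ := 𝟙 _, τ₃ := kernel.ι c }).2 hab }
  -- g dies in E₃, hence lands in ker c = im b. It lifts to E₁ because the extension of X by E₀
  -- pulled back along g' splits.
  let g' : X ⟶ kernel c := kernel.lift c g (hom hX h₃ _)
  have hg' : g' ≫ kernel.ι c = g := kernel.lift_ι _ _ _
  have sq := IsPullback.of_hasPullback e g'
  have hE := shortExact_lift_of_isPullback hS sq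
  obtain ⟨r, hr⟩ := ext hE h₀ hX
  have : Epi (pullback.snd e g') := hE.epi_g
  obtain ⟨s, hs⟩ := hE.exact.desc' (𝟙 _ - r ≫ sq.lift a 0 (by simp [hae])) (by
    dsimp
    rw [Preadditive.comp_sub, reassoc_of% hr, Category.comp_id, sub_self])
  dsimp at hs
  have hs' : s ≫ pullback.snd e g' = 𝟙 X := by
    rw [← cancel_epi (pullback.snd e g'), reassoc_of% hs, Preadditive.sub_comp, Category.assoc,
      sq.lift_snd]
    simp
  refine ⟨s ≫ pullback.fst e g', ?_⟩
  have hfst : pullback.fst e g' ≫ b = pullback.snd e g' ≫ g :=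
    (congrArg (pullback.fst e g' ≫ ·) he).symm.trans
      ((pullback.condition_assoc _).trans (congrArg (pullback.snd e g' ≫ ·) hg'))
  rw [Category.assoc, hfst, reassoc_of% hs']

/-- In a five-term exact sequence with terms in `Q, P, -, Q, P`, where `Hom` and `Ext¹` from `P`
to `Q` vanish, the third map is a `Q`-reflection. -/
theorem isReflection_of_exact
    (hom : ∀ {X N : C}, P X → Q N → ∀ g : X ⟶ N, g = 0)
    (ext : ∀ {N E X : C} {i : N ⟶ E} {p : E ⟶ X} {w : i ≫ p = 0},
      (ShortComplex.mk i p w).ShortExact → Q N → P X → ∃ r : E ⟶ N, i ≫ r = 𝟙 N)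
    {E₁ E₂ E₃ E₄ : C} {b : E₁ ⟶ E₂} {c : E₂ ⟶ E₃} {d : E₃ ⟶ E₄} (hd : Epi d)
    {wbc : b ≫ c = 0} (hbc : (ShortComplex.mk b c wbc).Exact)
    {wcd : c ≫ d = 0} (hcd : (ShortComplex.mk c d wcd).Exact)
    (h₁ : P E₁) (h₃ : Q E₃) (h₄ : P E₄) : IsReflection Q c := by
  refine ⟨h₃, fun N hN g => ?_⟩
  have huniq : ∀ h : E₃ ⟶ N, c ≫ h = 0 → h = 0 := fun h hh => by
    obtain ⟨l, hl⟩ := hcd.desc' h hh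
    rw [← hl, hom h₄ hN l, comp_zero]
  suffices ∃ h, c ≫ h = g by
    obtain ⟨h, hh⟩ := this
    refine ⟨h, hh, fun h' hh' => ?_⟩
    rw [← sub_eq_zero]
    exact huniq _ (by rw [Preadditive.comp_sub, hh, hh', sub_self])
  let e : cokernel b ⟶ E₃ := cokernel.desc b c wbc
  have he : cokernel.π b ≫ e = c := cokernel.π_desc _ _ _
  have hmono : Mono e := hbc.mono_cokernelDesc
  have hed : e ≫ d = 0 := by
    rw [← cancel_epi (cokernel.π b), ← Category.assoc, he, wcd, comp_zero]
  have hS : (ShortComplex.mk e d hed).ShortExact :=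
    { mono_f := hmono
      epi_g := hd
      exact := (ShortComplex.exact_iff_of_epi_of_isIso_of_mono
        (S₁ := ShortComplex.mk c d wcd) (S₂ := ShortComplex.mk e d hed)
        { τ₁ := cokernel.π b, τ₂ := 𝟙 _, τ₃ := 𝟙 _ }).1 hcd }
  -- g kills im b, so it factors through coker b, a subobject of E₃ with quotient E₄. It extends to
  -- E₃ because the extension of E₄ by N pushed out along g' splits.
  let g' : cokernel b ⟶ N := cokernel.desc b g (hom h₁ hN _)
  have hg' : cokernel.π b ≫ g' = g := cokernel.π_desc _ _ _
  have sq := IsPushout.of_hasPushout e g'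
  have hE := shortExact_desc_of_isPushout hS sq
  obtain ⟨r, hr⟩ := ext hE hN h₄
  refine ⟨pushout.inl e g' ≫ r, ?_⟩
  have hinl : c ≫ pushout.inl e g' = g ≫ pushout.inr e g' := by
    refine (congrArg (· ≫ pushout.inl e g') he).symm.trans
      (Eq.trans ?_ (congrArg (· ≫ pushout.inr e g') hg'))
    rw [Category.assoc, Category.assoc, pushout.condition]
  rw [reassoc_of% hinl, hr, Category.comp_id]

end FiveTerm

/-! ### Membership in 𝒳₀ of kernels and cokernels. -/

section Cokernel

variable {R S : Type u} [Ring R] [Ring S] {f : R →+* S}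

/-- Under T the map M → im r stays epi and is mono because T r is, hence is invertible. So T inverts
im r → Y as well, and 0 → im r → Y → coker r → 0 has acyclic middle term. -/
theorem classX_cokernel {M Y : ModuleCat.{u} Rᵐᵒᵖ} (r : M ⟶ Y) (hY : TorAcyclic f Y)
    (hT : IsIso ((tensorS f).map r)) : classX f (cokernel r) := by
  have hTi : (tensorS f).map (Abelian.factorThruImage r) ≫
      (tensorS f).map (Abelian.image.ι r) = (tensorS f).map r := by
    rw [← Functor.map_comp, Abelian.image.fac]
  rw [classX_iff]
  constructor
  · have h1 : (tensorS f).map (cokernel.π r) = 0 := by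
      rw [← cancel_epi ((tensorS f).map r), ← Functor.map_comp, cokernel.condition,
        Functor.map_zero, comp_zero]
    rw [IsZero.iff_id_eq_zero, ← cancel_epi ((tensorS f).map (cokernel.π r)), h1, zero_comp,
      zero_comp]
  · have hS : (ShortComplex.mk (Abelian.image.ι r) (cokernel.π r)
        (kernel.condition _)).ShortExact := { exact := ShortComplex.exact_kernel _ }
    refine IsTAcyclic.of_mono hS hY ?_
    have h1 : Mono ((tensorS f).map (Abelian.factorThruImage r)) := mono_of_mono_fac hTi
    have h2 : IsIso ((tensorS f).map (Abelian.factorThruImage r)) := isIso_of_mono_of_epi _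
    rw [← IsIso.eq_inv_comp] at hTi
    rw [hTi]
    infer_instance

/-- X and im v are submodules of acyclic modules, hence acyclic. So T X → T Q is mono, and T Q → T
(im v) is mono because T v is; their composite is zero, which forces T X = 0. -/
theorem classX_of_isKernel (hR : WeakGlobalDimLEOne R) {X Q Y : ModuleCat.{u} Rᵐᵒᵖ}
    (hQ : TorAcyclic f Q) (hY : TorAcyclic f Y) {i : X ⟶ Q} {v : Q ⟶ Y} [Mono i]
    {w : i ≫ v = 0} (hi : (ShortComplex.mk i v w).Exact)
    (hv : Mono ((tensorS f).map v)) : classX f X := by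
  rw [classX_iff]
  refine ⟨?_, hQ.of_mono hR i⟩
  let e := Abelian.factorThruImage v
  have he : e ≫ Abelian.image.ι v = v := Abelian.image.fac v
  have hie : i ≫ e = 0 := by
    rw [← cancel_mono (Abelian.image.ι v), Category.assoc, he, w, zero_comp]
  have hS : (ShortComplex.mk i e hie).ShortExact :=
    { exact := (ShortComplex.exact_iff_of_epi_of_isIso_of_mono
        (S₁ := ShortComplex.mk i e hie) (S₂ := ShortComplex.mk i v w)
        { τ₁ := 𝟙 _, τ₂ := 𝟙 _, τ₃ := Abelian.image.ι v }).2 hi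
      epi_g := inferInstanceAs (Epi (Abelian.factorThruImage v)) }
  have hI : TorAcyclic f (Abelian.image v) := hY.of_mono hR (Abelian.image.ι v)
  have h1 : Mono ((tensorS f).map i) := hI _ _ _ hS
  have h2 : Mono ((tensorS f).map e) := by
    rw [← he, Functor.map_comp] at hv
    exact mono_of_mono _ ((tensorS f).map (Abelian.image.ι v))
  have h3 : (tensorS f).map i = 0 := by
    rw [← cancel_mono ((tensorS f).map e), ← Functor.map_comp, hie, Functor.map_zero, zero_comp]
  rw [IsZero.iff_id_eq_zero, ← cancel_mono ((tensorS f).map i), h3, comp_zero, comp_zero]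

end Cokernel

/-! ### Extending maps between five-term sequences. -/

section Sequences

variable {C : Type*} [Category* C] [Abelian C] {P Q : ObjectProperty C}

/-- Uniqueness and existence of extensions of maps between five-term exact sequences. -/
theorem existsUnique_hom_of_isCoreflection_of_isReflection {E E' : ComposableArrows C 4}
    (hE : IsFiveTermExact E) (hE' : IsFiveTermExact E')
    (hP : P (E.obj 1)) (hP' : IsCoreflection P (E'.map' 1 2))
    (hQ : IsReflection Q (E.map' 2 3)) (hQ' : Q (E'.obj 3)) (φ : E.obj 2 ⟶ E'.obj 2) :
    ∃! Φ : E ⟶ E', Φ.app 2 = φ := by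
  have := hE.epi
  have := hE'.mono
  obtain ⟨φ₁, h₁, u₁⟩ := hP'.2 _ hP (E.map' 1 2 ≫ φ)
  obtain ⟨φ₃, h₃, u₃⟩ := hQ.2 _ hQ' (φ ≫ E'.map' 2 3)
  obtain ⟨φ₀, h₀⟩ := (hE'.exact.exact' 0 1 2).lift' (E.map' 0 1 ≫ φ₁) (by
    dsimp
    rw [Category.assoc, h₁, ← Category.assoc, hE.exact.toIsComplex.zero' 0 1 2, zero_comp])
  obtain ⟨φ₄, h₄⟩ := (hE.exact.exact' 2 3 4).desc' (φ₃ ≫ E'.map' 3 4) (by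
    dsimp
    rw [← Category.assoc, h₃, Category.assoc, hE'.exact.toIsComplex.zero' 2 3 4, comp_zero])
  refine ⟨ComposableArrows.homMk₄ φ₀ φ₁ φ φ₃ φ₄ h₀.symm h₁.symm h₃ h₄, rfl, fun Ψ hΨ => ?_⟩
  have n01 := ComposableArrows.naturality' Ψ 0 1
  have n12 := ComposableArrows.naturality' Ψ 1 2
  have n23 := ComposableArrows.naturality' Ψ 2 3
  have n34 := ComposableArrows.naturality' Ψ 3 4
  replace hΨ : ComposableArrows.app' Ψ 2 = φ := hΨ
  rw [hΨ] at n12 n23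
  have k₁ : ComposableArrows.app' Ψ 1 = φ₁ := u₁ _ n12.symm
  have k₃ : ComposableArrows.app' Ψ 3 = φ₃ := u₃ _ n23
  rw [k₁] at n01
  rw [k₃] at n34
  refine ComposableArrows.hom_ext₄ ?_ k₁ hΨ k₃ ?_
  · exact hE'.mono.right_cancellation _ _ (n01.symm.trans h₀.symm)
  · exact hE.epi.left_cancellation _ _ (n34.trans h₄.symm)

omit [Abelian C] in
/-- Extension of isomorphisms between five-term exact sequences. -/
theorem existsUnique_iso_of_existsUnique_hom {E E' : ComposableArrows C 4}
    (h : ∀ F ∈ ({E, E'} : Set (ComposableArrows C 4)), ∀ G ∈ ({E, E'} : Set (ComposableArrows C 4)),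
      ∀ φ : F.obj 2 ⟶ G.obj 2, ∃! Φ : F ⟶ G, Φ.app 2 = φ) (φ : E.obj 2 ≅ E'.obj 2) :
    ∃! Φ : E ≅ E', Φ.hom.app 2 = φ.hom := by
  obtain ⟨Φ, h1, u1⟩ := h E (by simp) E' (by simp) φ.hom
  obtain ⟨Ψ, h2, u2⟩ := h E' (by simp) E (by simp) φ.inv
  -- Uniqueness for endomorphisms of E and of E' turns both composites into identities; hence `h`
  -- covers all four pairs.
  refine ⟨⟨Φ, Ψ, ?_, ?_⟩, h1, fun Φ' h' => ?_⟩
  · refine (h E (by simp) E (by simp) (𝟙 _)).unique ?_ rfl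
    rw [NatTrans.comp_app, h1, h2, φ.hom_inv_id]
  · refine (h E' (by simp) E' (by simp) (𝟙 _)).unique ?_ rfl
    rw [NatTrans.comp_app, h1, h2, φ.inv_hom_id]
  · ext1
    exact u1 _ h'

end Sequences

/-! ### Functors preserving filtered colimits. -/

section FilteredColimits

variable {C : Type*} [Category* C] {D : Type*} [Category* D] {K : Type*} [Category* K]
  (J : Type*) [Category* J]

theorem preservesColimitsOfShape_colimit [HasColimitsOfShape K D] (G : K ⥤ C ⥤ D)
    [HasColimitsOfShape J D]
    (hG : ∀ k, PreservesColimitsOfShape J (G.obj k)) :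
    PreservesColimitsOfShape J (colimit G) := by
  have : PreservesColimitsOfShape J G.flip :=
    preservesColimitsOfShape_of_evaluation _ _ fun k => hG k
  exact preservesColimitsOfShape_of_natIso (colimitIsoFlipCompColim G).symm

variable {A : Type u} [Ring A] (J : Type u) [SmallCategory J]
  {G G' G'' : C ⥤ ModuleCat.{u} A}

omit [SmallCategory J] in
theorem isIso_of_exact_of_isIso {X Y Z X' Y' Z' : ModuleCat.{u} A} {i : X ⟶ Y} {g : Y ⟶ Z}
    {i' : X' ⟶ Y'} {g' : Y' ⟶ Z'} (hi : Mono i) (hi' : Mono i') {w : i ≫ g = 0} {w' : i' ≫ g' = 0}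
    (h : (ShortComplex.mk i g w).Exact) {a : X ⟶ X'} {b : Y ⟶ Y'} {c : Z ⟶ Z'}
    (e₁ : a ≫ i' = i ≫ b) (e₂ : b ≫ g' = g ≫ c) (hb : IsIso b) (hc : Mono c) : IsIso a := by
  have hm : Mono a := by
    have : Mono (a ≫ i') := by
      rw [e₁]
      infer_instance
    exact mono_of_mono _ i'
  have he : Epi a := by
    rw [ModuleCat.epi_iff_surjective]
    intro x
    obtain ⟨y, hy⟩ := (ModuleCat.epi_iff_surjective b).1 inferInstance (i' x)
    obtain ⟨z, hz⟩ := (ShortComplex.moduleCat_exact_iff _).1 h y (by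
      refine (ModuleCat.mono_iff_injective c).1 inferInstance ?_
      dsimp
      rw [← ConcreteCategory.comp_apply, ← e₂, ConcreteCategory.comp_apply, hy,
        ← ConcreteCategory.comp_apply, w', map_zero]
      rfl)
    refine ⟨z, (ModuleCat.mono_iff_injective i').1 hi' ?_⟩
    dsimp at hz
    rw [← ConcreteCategory.comp_apply, e₁, ConcreteCategory.comp_apply, hz, hy]
  exact isIso_of_mono_of_epi _

/-- A kernel of functors preserving filtered colimits preserves filtered colimits. -/
theorem preservesColimitsOfShape_of_isKernel [IsFiltered J] [HasColimitsOfShape J C]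
    (i : G ⟶ G') (g : G' ⟶ G'') (hi : Mono i) (w : i ≫ g = 0) (h : (ShortComplex.mk i g w).Exact)
    [PreservesColimitsOfShape J G'] [PreservesColimitsOfShape J G''] :
    PreservesColimitsOfShape J G where
  preservesColimit {F} := by
    have hi' : Mono (Functor.whiskerLeft F i) := by
      have : ∀ j, Mono ((Functor.whiskerLeft F i).app j) := fun j =>
        inferInstanceAs (Mono (i.app (F.obj j)))
      exact NatTrans.mono_of_mono_app _
    have wF : Functor.whiskerLeft F i ≫ Functor.whiskerLeft F g = 0 := by
      rw [← Functor.whiskerLeft_comp, w]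
      rfl
    have hF : (ShortComplex.mk _ _ wF).Exact := h.map ((Functor.whiskeringLeft _ _ _).obj F)
    have wpt : i.app (colimit F) ≫ g.app (colimit F) = 0 := by
      rw [← NatTrans.comp_app, w]
      rfl
    -- Filtered colimits of modules are exact, so both rows are kernel rows, and the comparison maps
    -- of G' and G'' are isomorphisms.
    have hpost : IsIso (colimit.post F G) :=
      isIso_of_exact_of_isIso (i := colim.map (Functor.whiskerLeft F i))
        (g := colim.map (Functor.whiskerLeft F g)) (i' := i.app (colimit F))
        (g' := g.app (colimit F)) inferInstance inferInstance (w' := wpt)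
        (hF.map (colim : (J ⥤ ModuleCat.{u} A) ⥤ _))
        (a := colimit.post F G) (b := colimit.post F G') (c := colimit.post F G'')
        (colimit.hom_ext fun j => by simp) (colimit.hom_ext fun j => by simp)
        inferInstance inferInstance
    exact preservesColimit_of_isIso_post G F

theorem preservesColimitsOfShape_cokernel (g : G ⟶ G') [hG : PreservesColimitsOfShape J G]
    [hG' : PreservesColimitsOfShape J G'] : PreservesColimitsOfShape J (cokernel g) :=
  preservesColimitsOfShape_colimit J _ fun k => by
    cases k
    · exact hG
    · exact hG'

theorem preservesColimitsOfShape_pushout (g : G ⟶ G') (g' : G ⟶ G'')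
    [hG : PreservesColimitsOfShape J G] [hG' : PreservesColimitsOfShape J G']
    [hG'' : PreservesColimitsOfShape J G''] : PreservesColimitsOfShape J (pushout g g') :=
  preservesColimitsOfShape_colimit J _ fun k => by
    rcases k with _ | _ | _
    · exact hG
    · exact hG'
    · exact hG''

end FilteredColimits

/-! ### The diagram chase and the properties of the pushout Q. -/

section Pointwise

variable {B : Type u} [Ring B]

/-- Read N, FN, MN as K ⊗ S, F ⊗ S, M ⊗ S, and L, X as Tor_1(M, S), X_M. Since ker β = N, the kernel
of X → M is N ∩ ker v = ker n = L. If m = β q dies in MN, then v q = n y for some y, and q - j y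
lies in X and still maps to m. -/
theorem fiveTerm_exact {K F M N FN MN X Q L : ModuleCat.{u} B} {k : K ⟶ F} {e : F ⟶ M}
    {w : k ≫ e = 0} (hS : (ShortComplex.mk k e w).ShortExact) {u : K ⟶ N} {l : F ⟶ Q} {j : N ⟶ Q}
    (sq : IsPushout k u l j) {n : N ⟶ FN} {uF : F ⟶ FN} {v : Q ⟶ FN} (hlv : l ≫ v = uF)
    (hjv : j ≫ v = n) {β : Q ⟶ M} (hlβ : l ≫ β = e) (hjβ : j ≫ β = 0) {δ : L ⟶ N} (_ : Mono δ)
    {wδ : δ ≫ n = 0} (hδ : (ShortComplex.mk δ n wδ).Exact) {i : X ⟶ Q} (_ : Mono i) {wi : i ≫ v = 0}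
    (hi : (ShortComplex.mk i v wi).Exact) {a : L ⟶ X} (ha : a ≫ i = δ ≫ j) {p : FN ⟶ MN}
    {uM : M ⟶ MN} (hp : uF ≫ p = e ≫ uM) {wn : n ≫ p = 0} (hn : (ShortComplex.mk n p wn).Exact) :
    Mono a ∧ (∃ w : a ≫ i ≫ β = 0, (ShortComplex.mk a (i ≫ β) w).Exact) ∧
      ∃ w : (i ≫ β) ≫ uM = 0, (ShortComplex.mk (i ≫ β) uM w).Exact := by
  have hβ : β = sq.desc e 0 (by simp [w]) := sq.hom_ext (by simp [hlβ]) (by simp [hjβ])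
  have hQ := shortExact_desc_of_isPushout hS sq
  have hj : Mono j := hQ.mono_f
  have hβe : Epi β := by rw [hβ]; exact hQ.epi_g
  have hjβe : (ShortComplex.mk j β hjβ).Exact := by subst hβ; exact hQ.exact
  have hβu : β ≫ uM = v ≫ p := sq.hom_ext
    (by rw [reassoc_of% hlβ, reassoc_of% hlv, hp])
    (by rw [reassoc_of% hjβ, reassoc_of% hjv, wn, zero_comp])
  refine ⟨(have : Mono (δ ≫ j) := mono_comp _ _; mono_of_mono_fac ha), ⟨?_, ?_⟩, ?_, ?_⟩
  · rw [reassoc_of% ha, hjβ, comp_zero]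
  · rw [ShortComplex.moduleCat_exact_iff]
    intro x hx
    obtain ⟨y, hy⟩ := (ShortComplex.moduleCat_exact_iff _).1 hjβe (i x) hx
    dsimp at y hy x
    have hny : n y = 0 := by
      rw [← hjv, ConcreteCategory.comp_apply, hy, ← ConcreteCategory.comp_apply, wi]
      rfl
    obtain ⟨z, hz⟩ := (ShortComplex.moduleCat_exact_iff _).1 hδ y hny
    refine ⟨z, (ModuleCat.mono_iff_injective i).1 inferInstance ?_⟩
    dsimp at hz ⊢
    rw [← ConcreteCategory.comp_apply, ha, ConcreteCategory.comp_apply, hz, hy]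
  · rw [Category.assoc, hβu, reassoc_of% wi, zero_comp]
  · rw [ShortComplex.moduleCat_exact_iff]
    intro m hm
    dsimp at m hm
    obtain ⟨q, rfl⟩ := (ModuleCat.epi_iff_surjective β).1 hβe m
    have hvp : p (v q) = 0 := (ConcreteCategory.congr_hom hβu q).symm.trans hm
    obtain ⟨y, hy⟩ := (ShortComplex.moduleCat_exact_iff _).1 hn (v q) hvp
    dsimp at y hy
    have hvj : v (j y) = n y := ConcreteCategory.congr_hom hjv y
    obtain ⟨x, hx⟩ := (ShortComplex.moduleCat_exact_iff _).1 hi (q - j y)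
      ((map_sub _ _ _).trans (by rw [hvj]; exact sub_eq_zero.2 hy.symm))
    have hβj : β (j y) = 0 := ConcreteCategory.congr_hom hjβ y
    exact ⟨x, (congrArg β hx).trans ((map_sub _ _ _).trans (by rw [hβj, sub_zero]))⟩

variable {R S : Type u} [Ring R] [Ring S] {f : R →+* S}

/-- In 0 → K → F ⊕ N → Q → 0 the middle term is acyclic, and T of the first map is mono because its
component -T u is. -/
theorem torAcyclic_pushout {K F N Q : ModuleCat.{u} Rᵐᵒᵖ} {k : K ⟶ F} {u : K ⟶ N} {l : F ⟶ Q}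
    {j : N ⟶ Q} [Mono k] (sq : IsPushout k u l j) (hF : TorAcyclic f F) (hN : TorAcyclic f N)
    (hu : IsIso ((tensorS f).map u)) : TorAcyclic f Q := by
  have hS : sq.shortComplex.ShortExact :=
    { exact := sq.exact_shortComplex
      mono_f :=
        have : Mono (biprod.lift k (-u) ≫ biprod.fst) := by
          rw [biprod.lift_fst]
          infer_instance
        mono_of_mono (biprod.lift k (-u)) biprod.fst
      epi_g := sq.epi_shortComplex_g }
  refine IsTAcyclic.of_mono hS (IsTAcyclic.biprod hF hN) ?_
  have h1 : (tensorS f).map (biprod.lift k (-u)) ≫ (tensorS f).map biprod.snd =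
      -(tensorS f).map u := by
    rw [← Functor.map_comp, biprod.lift_snd, Functor.map_neg]
  have : Mono (-(tensorS f).map u) := by
    refine Preadditive.mono_of_cancel_zero _ fun g hg => ?_
    rw [Preadditive.comp_neg, neg_eq_zero] at hg
    exact (cancel_mono ((tensorS f).map u)).1 (hg.trans zero_comp.symm)
  exact mono_of_mono_fac h1

theorem isIso_tensorS_map_of_isPushout {K F N Q Y : ModuleCat.{u} Rᵐᵒᵖ} {k : K ⟶ F} {u : K ⟶ N}
    {l : F ⟶ Q} {j : N ⟶ Q} (sq : IsPushout k u l j) (hu : IsIso ((tensorS f).map u)) {v : Q ⟶ Y}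
    (hv : IsIso ((tensorS f).map (l ≫ v))) : IsIso ((tensorS f).map v) := by
  have sq' := sq.map (tensorS f)
  have : IsIso ((tensorS f).map l) := sq'.isIso_inl_of_isIso
  rw [Functor.map_comp] at hv
  exact IsIso.of_isIso_comp_left ((tensorS f).map l) _

end Pointwise

theorem exact_of_exact_app {C : Type*} [Category* C] {D : Type*} [Category* D] [Abelian D]
    {S : ShortComplex (C ⥤ D)} (h : ∀ X, (S.map ((evaluation C D).obj X)).Exact) : S.Exact :=
  (ShortComplex.exact_iff_isZero_homology _).2 (Functor.isZero _ fun X =>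
    ((ShortComplex.exact_iff_isZero_homology _).1 (h X)).of_iso
      (S.mapHomologyIso ((evaluation C D).obj X)).symm)

/-! ### The functors M ↦ X_M and M ↦ X^M. -/

section Construction

variable (R : Type u) [Ring R]

/-- The functorial free cover of a right module: the free module on its elements. -/
def freeCover : ModuleCat.{u} Rᵐᵒᵖ ⥤ ModuleCat.{u} Rᵐᵒᵖ :=
  forget (ModuleCat.{u} Rᵐᵒᵖ) ⋙ ModuleCat.free Rᵐᵒᵖ

def freeCoverπ : freeCover R ⟶ 𝟭 (ModuleCat.{u} Rᵐᵒᵖ) := (ModuleCat.adj Rᵐᵒᵖ).counit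

instance (M : ModuleCat.{u} Rᵐᵒᵖ) : Projective ((freeCover R).obj M) :=
  ModuleCat.projective_of_free (Finsupp.basisSingleOne (R := Rᵐᵒᵖ) (ι := M))

instance : Epi (freeCoverπ R) := by
  have : ∀ M, Epi ((freeCoverπ R).app M) := fun M =>
    inferInstanceAs (Epi ((ModuleCat.adj Rᵐᵒᵖ).counit.app M))
  exact NatTrans.epi_of_epi_app _

/-- The cover by the free module on all elements is chosen for this: the forgetful functor preserves
filtered colimits and the free functor is a left adjoint. -/
instance (J : Type u) [SmallCategory J] [IsFiltered J] :
    PreservesColimitsOfShape J (freeCover R) :=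
  have : (ModuleCat.free.{u} Rᵐᵒᵖ).IsLeftAdjoint := (ModuleCat.adj Rᵐᵒᵖ).isLeftAdjoint
  inferInstanceAs (PreservesColimitsOfShape J
    (forget (ModuleCat.{u} Rᵐᵒᵖ) ⋙ ModuleCat.free Rᵐᵒᵖ))

def syzygy : ModuleCat.{u} Rᵐᵒᵖ ⥤ ModuleCat.{u} Rᵐᵒᵖ := kernel (freeCoverπ R)

def syzygyι : syzygy R ⟶ freeCover R := kernel.ι (freeCoverπ R)

instance : Mono (syzygyι R) := inferInstanceAs (Mono (kernel.ι (freeCoverπ R)))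

theorem syzygyι_comp : syzygyι R ≫ freeCoverπ R = 0 := kernel.condition _

theorem syzygy_shortExact :
    (ShortComplex.mk (syzygyι R) (freeCoverπ R) (syzygyι_comp R)).ShortExact where
  exact := ShortComplex.exact_of_f_is_kernel _ (kernelIsKernel _)
  mono_f := inferInstanceAs (Mono (syzygyι R))
  epi_g := inferInstanceAs (Epi (freeCoverπ R))

theorem syzygyι_app_comp (M : ModuleCat.{u} Rᵐᵒᵖ) :
    (syzygyι R).app M ≫ (freeCoverπ R).app M = 0 :=
  congrArg (fun t => t.app M) (syzygyι_comp R)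

theorem syzygy_app_shortExact (M : ModuleCat.{u} Rᵐᵒᵖ) :
    (ShortComplex.mk ((syzygyι R).app M) ((freeCoverπ R).app M)
      (syzygyι_app_comp R M)).ShortExact :=
  (syzygy_shortExact R).map_of_exact ((evaluation _ _).obj M)

instance (M : ModuleCat.{u} Rᵐᵒᵖ) : Mono ((syzygyι R).app M) := (syzygy_app_shortExact R M).mono_f

instance (J : Type u) [SmallCategory J] [IsFiltered J] :
    PreservesColimitsOfShape J (syzygy R) :=
  preservesColimitsOfShape_of_isKernel J _ _ inferInstance _ (syzygy_shortExact R).exact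

variable {R} {S : Type u} [Ring S] (f : R →+* S)

/-- `- ⊗_R S` as an endofunctor of `Mod-R`. -/
def localize : ModuleCat.{u} Rᵐᵒᵖ ⥤ ModuleCat.{u} Rᵐᵒᵖ := tensorS f ⋙ restrict f

instance (J : Type u) [SmallCategory J] : PreservesColimitsOfShape J (localize f) :=
  inferInstanceAs (PreservesColimitsOfShape J (tensorS f ⋙ restrict f))

instance : (localize f).Additive := inferInstanceAs (tensorS f ⋙ restrict f).Additive

/-- `G(M) → G(M) ⊗_R S`. -/
def localizeUnit (G : ModuleCat.{u} Rᵐᵒᵖ ⥤ ModuleCat.{u} Rᵐᵒᵖ) : G ⟶ G ⋙ localize f where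
  app M := (unitS f).app (G.obj M)
  naturality _ _ g := (unitS f).naturality (G.map g)

theorem localizeUnit_naturality {G G' : ModuleCat.{u} Rᵐᵒᵖ ⥤ ModuleCat.{u} Rᵐᵒᵖ} (g : G ⟶ G') :
    localizeUnit f G ≫ Functor.whiskerRight g (localize f) = g ≫ localizeUnit f G' := by
  ext1
  funext M
  exact ((unitS f).naturality (g.app M)).symm

/-- The pushout of the free cover of `M` along `K → K ⊗_R S`, `K` the syzygy of `M`. -/
def cover : ModuleCat.{u} Rᵐᵒᵖ ⥤ ModuleCat.{u} Rᵐᵒᵖ :=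
  pushout (syzygyι R) (localizeUnit f (syzygy R))

def coverInl : freeCover R ⟶ cover f := pushout.inl _ _

def coverInr : syzygy R ⋙ localize f ⟶ cover f := pushout.inr _ _

theorem cover_isPushout :
    IsPushout (syzygyι R) (localizeUnit f (syzygy R)) (coverInl f) (coverInr f) :=
  IsPushout.of_hasPushout _ _

theorem cover_isPushout_app (M : ModuleCat.{u} Rᵐᵒᵖ) :
    IsPushout ((syzygyι R).app M) ((unitS f).app ((syzygy R).obj M)) ((coverInl f).app M)
      ((coverInr f).app M) :=
  (cover_isPushout f).map ((evaluation _ _).obj M)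

instance (J : Type u) [SmallCategory J] [IsFiltered J] : PreservesColimitsOfShape J (cover f) :=
  preservesColimitsOfShape_pushout J _ _

def coverToLocalize : cover f ⟶ freeCover R ⋙ localize f :=
  (cover_isPushout f).desc (localizeUnit f (freeCover R))
    (Functor.whiskerRight (syzygyι R) (localize f)) (localizeUnit_naturality f _).symm

def coverπ : cover f ⟶ 𝟭 (ModuleCat.{u} Rᵐᵒᵖ) :=
  (cover_isPushout f).desc (freeCoverπ R) 0 ((syzygyι_comp R).trans comp_zero.symm)

theorem coverInl_toLocalize : coverInl f ≫ coverToLocalize f = localizeUnit f (freeCover R) :=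
  (cover_isPushout f).inl_desc _ _ _

theorem coverInr_toLocalize :
    coverInr f ≫ coverToLocalize f = Functor.whiskerRight (syzygyι R) (localize f) :=
  (cover_isPushout f).inr_desc _ _ _

theorem coverInl_π : coverInl f ≫ coverπ f = freeCoverπ R :=
  (cover_isPushout f).inl_desc _ _ _

theorem coverInr_π : coverInr f ≫ coverπ f = 0 :=
  (cover_isPushout f).inr_desc _ _ _

/-- The functor `M ↦ X_M`. -/
def lowerX : ModuleCat.{u} Rᵐᵒᵖ ⥤ ModuleCat.{u} Rᵐᵒᵖ := kernel (coverToLocalize f)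

def lowerXι : lowerX f ⟶ cover f := kernel.ι (coverToLocalize f)

instance : Mono (lowerXι f) := inferInstanceAs (Mono (kernel.ι (coverToLocalize f)))

theorem mono_lowerXι_app (M : ModuleCat.{u} Rᵐᵒᵖ) : Mono ((lowerXι f).app M) :=
  inferInstanceAs (Mono (((evaluation _ _).obj M).map (lowerXι f)))

theorem lowerXι_comp : lowerXι f ≫ coverToLocalize f = 0 := kernel.condition _

theorem lowerX_exact :
    (ShortComplex.mk (lowerXι f) (coverToLocalize f) (lowerXι_comp f)).Exact :=
  ShortComplex.exact_of_f_is_kernel _ (kernelIsKernel _)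

theorem lowerXι_app_comp (M : ModuleCat.{u} Rᵐᵒᵖ) :
    (lowerXι f).app M ≫ (coverToLocalize f).app M = 0 :=
  congrArg (fun t => t.app M) (lowerXι_comp f)

theorem lowerX_app_exact (M : ModuleCat.{u} Rᵐᵒᵖ) :
    (ShortComplex.mk ((lowerXι f).app M) ((coverToLocalize f).app M)
      (lowerXι_app_comp f M)).Exact :=
  (lowerX_exact f).map ((evaluation _ _).obj M)

instance (J : Type u) [SmallCategory J] [IsFiltered J] : PreservesColimitsOfShape J (lowerX f) :=
  preservesColimitsOfShape_of_isKernel J _ _ inferInstance _ (lowerX_exact f)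

/-- `X_M → M`. -/
def lowerXπ : lowerX f ⟶ 𝟭 (ModuleCat.{u} Rᵐᵒᵖ) := lowerXι f ≫ coverπ f

/-- The connecting map `Tor_1^R(M, S) → K ⊗_R S`, `K` the syzygy of `M`. -/
def torConnecting : torS f 1 ⋙ restrict f ⟶ syzygy R ⋙ localize f where
  app M := (restrict f).map (connecting (tensorS f) (syzygy_app_shortExact R M))
  naturality M M' g := by
    have := connecting_naturality (tensorS f) (syzygy_app_shortExact R M)
      (syzygy_app_shortExact R M') ((syzygy R).map g) ((freeCover R).map g) g
      ((syzygyι R).naturality g).symm ((freeCoverπ R).naturality g).symm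
    exact ((restrict f).map_comp _ _).symm.trans
      ((congrArg (restrict f).map this).trans ((restrict f).map_comp _ _))

theorem mono_torConnecting_app (M : ModuleCat.{u} Rᵐᵒᵖ) : Mono ((torConnecting f).app M) :=
  (mono_restrict_map_iff _).2 (mono_connecting (tensorS f) (syzygy_app_shortExact R M))

instance : Mono (torConnecting f) :=
  have := mono_torConnecting_app f
  NatTrans.mono_of_mono_app _

theorem torConnecting_comp :
    torConnecting f ≫ Functor.whiskerRight (syzygyι R) (localize f) = 0 := by
  ext1
  funext M
  exact ((restrict f).map_comp _ _).symm.trans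
    ((congrArg (restrict f).map (connecting_comp (tensorS f) (syzygy_app_shortExact R M))).trans
      ((restrict f).map_zero _ _))

theorem torConnecting_app_comp (M : ModuleCat.{u} Rᵐᵒᵖ) :
    (torConnecting f).app M ≫ (localize f).map ((syzygyι R).app M) = 0 :=
  congrArg (fun t => t.app M) (torConnecting_comp f)

theorem torConnecting_app_exact (M : ModuleCat.{u} Rᵐᵒᵖ) :
    (ShortComplex.mk ((torConnecting f).app M) ((localize f).map ((syzygyι R).app M))
      (torConnecting_app_comp f M)).Exact :=
  (ShortComplex.moduleCat_exact_iff _).2 fun y hy =>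
    connecting_exact (tensorS f) (syzygy_app_shortExact R M) y hy

theorem torConnecting_exact :
    (ShortComplex.mk (torConnecting f) (Functor.whiskerRight (syzygyι R) (localize f))
      (torConnecting_comp f)).Exact :=
  exact_of_exact_app fun M => torConnecting_app_exact f M

/-- Tor_1(M, S) is, naturally in M, the kernel of K ⊗ S → F ⊗ S. -/
instance (J : Type u) [SmallCategory J] [IsFiltered J] :
    PreservesColimitsOfShape J (torS f 1 ⋙ restrict f) :=
  preservesColimitsOfShape_of_isKernel J _ _ inferInstance _ (torConnecting_exact f)

/-- `Tor_1^R(M, S) → X_M`. -/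
def torToLowerX : torS f 1 ⋙ restrict f ⟶ lowerX f :=
  kernel.lift (coverToLocalize f) (torConnecting f ≫ coverInr f)
    (by rw [Category.assoc, coverInr_toLocalize, torConnecting_comp])

theorem torToLowerX_comp : torToLowerX f ≫ lowerXι f = torConnecting f ≫ coverInr f :=
  kernel.lift_ι _ _ _

/-- The functor `M ↦ X^M`. -/
def upperX : ModuleCat.{u} Rᵐᵒᵖ ⥤ ModuleCat.{u} Rᵐᵒᵖ := cokernel (unitS f)

/-- `M ⊗_R S → X^M`. -/
def upperXπ : tensorS f ⋙ restrict f ⟶ upperX f := cokernel.π (unitS f)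

instance : Epi (upperXπ f) := inferInstanceAs (Epi (cokernel.π (unitS f)))

instance (J : Type u) [SmallCategory J] : PreservesColimitsOfShape J (upperX f) :=
  preservesColimitsOfShape_cokernel J _

theorem unitS_comp_upperXπ : unitS f ≫ upperXπ f = 0 := cokernel.condition _

theorem unitS_exact :
    (ShortComplex.mk (unitS f) (upperXπ f) (unitS_comp_upperXπ f)).Exact :=
  ShortComplex.exact_of_g_is_cokernel _ (cokernelIsCokernel _)

theorem unitS_app_comp (M : ModuleCat.{u} Rᵐᵒᵖ) :
    (unitS f).app M ≫ (upperXπ f).app M = 0 :=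
  congrArg (fun t => t.app M) (unitS_comp_upperXπ f)

theorem unitS_app_exact (M : ModuleCat.{u} Rᵐᵒᵖ) :
    (ShortComplex.mk ((unitS f).app M) ((upperXπ f).app M) (unitS_app_comp f M)).Exact :=
  (unitS_exact f).map ((evaluation _ _).obj M)

theorem epi_upperXπ_app (M : ModuleCat.{u} Rᵐᵒᵖ) : Epi ((upperXπ f).app M) :=
  inferInstanceAs (Epi (((evaluation _ _).obj M).map (upperXπ f)))

variable {f}

theorem classX_of_iso {X Y : ModuleCat.{u} Rᵐᵒᵖ} (e : X ≅ Y) (hX : classX f X) : classX f Y :=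
  ⟨hX.1.of_iso ((tensorS f).mapIso e).symm, hX.2.of_iso ((torS f 1).mapIso e).symm⟩

theorem torAcyclic_freeCover (M : ModuleCat.{u} Rᵐᵒᵖ) : TorAcyclic f ((freeCover R).obj M) :=
  isTAcyclic_of_projective _

theorem lowerX_app_exact_sequence (M : ModuleCat.{u} Rᵐᵒᵖ) :
    Mono ((torToLowerX f).app M) ∧
      (∃ w : (torToLowerX f).app M ≫ (lowerXπ f).app M = 0,
        (ShortComplex.mk ((torToLowerX f).app M) ((lowerXπ f).app M) w).Exact) ∧
      ∃ w : (lowerXπ f).app M ≫ (unitS f).app M = 0,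
        (ShortComplex.mk ((lowerXπ f).app M) ((unitS f).app M) w).Exact := by
  have hn : (localize f).map ((syzygyι R).app M) ≫ (localize f).map ((freeCoverπ R).app M) = 0 :=
    ((localize f).map_comp _ _).symm.trans
      ((congrArg (localize f).map (syzygyι_app_comp R M)).trans ((localize f).map_zero _ _))
  exact fiveTerm_exact (syzygy_app_shortExact R M) (cover_isPushout_app f M)
    (congrArg (fun t => t.app M) (coverInl_toLocalize f))
    (congrArg (fun t => t.app M) (coverInr_toLocalize f))
    (congrArg (fun t => t.app M) (coverInl_π f)) (congrArg (fun t => t.app M) (coverInr_π f))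
    (mono_torConnecting_app f M) (torConnecting_app_exact f M) (mono_lowerXι_app f M)
    (lowerX_app_exact f M)
    (congrArg (fun t => t.app M) (torToLowerX_comp f))
    ((unitS f).naturality ((freeCoverπ R).app M)).symm (wn := hn)
    ((ShortComplex.moduleCat_exact_iff _).2 (exact_map (syzygy_app_shortExact R M)))

variable [(restrict f).Full]

theorem classX_lowerX (hR : WeakGlobalDimLEOne R)
    (h : TorAcyclic f ((restrict f).obj (ModuleCat.of Sᵐᵒᵖ S))) (M : ModuleCat.{u} Rᵐᵒᵖ) :
    classX f ((lowerX f).obj M) := by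
  have := mono_lowerXι_app f M
  have hQ : TorAcyclic f ((cover f).obj M) :=
    torAcyclic_pushout (cover_isPushout_app f M) (torAcyclic_freeCover M)
      (torAcyclic_restrict h _) (isIso_tensorS_unitS_app f _)
  -- Composed with F → Q, the map Q → F ⊗ S becomes the unit of F, which T inverts.
  have hv : IsIso ((tensorS f).map ((coverToLocalize f).app M)) := by
    refine isIso_tensorS_map_of_isPushout (cover_isPushout_app f M)
      (isIso_tensorS_unitS_app f _) ?_
    have : (coverInl f).app M ≫ (coverToLocalize f).app M = (unitS f).app ((freeCover R).obj M) :=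
      congrArg (fun t => t.app M) (coverInl_toLocalize f)
    rw [this]
    exact isIso_tensorS_unitS_app f _
  exact classX_of_isKernel hR hQ (torAcyclic_restrict h _) (lowerX_app_exact f M)
    (@IsIso.mono_of_iso _ _ _ _ _ hv)

theorem classX_upperX (h : TorAcyclic f ((restrict f).obj (ModuleCat.of Sᵐᵒᵖ S)))
    (M : ModuleCat.{u} Rᵐᵒᵖ) : classX f ((upperX f).obj M) := by
  have hX := classX_cokernel ((unitS f).app M) (torAcyclic_restrict h _)
    (isIso_tensorS_unitS_app f M)
  have := epi_upperXπ_app f M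
  -- The cokernel of a natural transformation is computed pointwise.
  exact classX_of_iso ((colimit.isColimit _).coconePointUniqueUpToIso
    (unitS_app_exact f M).gIsCokernel) hX

end Construction

/-! ### Assembly of the sequences ε_M. -/

section FiveTerm

theorem isFiveTermExact_mk {C : Type*} [Category* C] [Abelian C] {E : ComposableArrows C 4}
    (h₀ : Mono (E.map' 0 1))
    (h₁ : ∃ w : E.map' 0 1 ≫ E.map' 1 2 = 0, (ShortComplex.mk (E.map' 0 1) (E.map' 1 2) w).Exact)
    (h₂ : ∃ w : E.map' 1 2 ≫ E.map' 2 3 = 0, (ShortComplex.mk (E.map' 1 2) (E.map' 2 3) w).Exact)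
    (h₃ : ∃ w : E.map' 2 3 ≫ E.map' 3 4 = 0, (ShortComplex.mk (E.map' 2 3) (E.map' 3 4) w).Exact)
    (h₄ : Epi (E.map' 3 4)) : IsFiveTermExact E where
  mono := h₀
  exact :=
    { zero := fun i hi => by
        obtain rfl | rfl | rfl : i = 0 ∨ i = 1 ∨ i = 2 := by lia
        exacts [h₁.1, h₂.1, h₃.1]
      exact := fun i hi => by
        obtain rfl | rfl | rfl : i = 0 ∨ i = 1 ∨ i = 2 := by lia
        exacts [h₁.2, h₂.2, h₃.2] }
  epi := h₄

variable {R S : Type u} [Ring R] [Ring S] (f : R →+* S)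

/-- The sequences `ε_M`, as a functor of `M`. -/
abbrev approxSeq : ModuleCat.{u} Rᵐᵒᵖ ⥤ ComposableArrows (ModuleCat.{u} Rᵐᵒᵖ) 4 :=
  (ComposableArrows.mk₄ (torToLowerX f) (lowerXπ f) (unitS f) (upperXπ f)).flip

theorem isFiveTermExact_approxSeq (M : ModuleCat.{u} Rᵐᵒᵖ) :
    IsFiveTermExact ((approxSeq f).obj M) := by
  obtain ⟨h₀, h₁, h₂⟩ := lowerX_app_exact_sequence (f := f) M
  exact isFiveTermExact_mk h₀ h₁ h₂ ⟨unitS_app_comp f M, unitS_app_exact f M⟩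
    (epi_upperXπ_app f M)

theorem preservesFilteredColimits_approxSeq :
    PreservesFilteredColimitsOfSize.{u, u} (approxSeq f) where
  preserves_filtered_colimits J _ _ := by
    -- Colimits of sequences are computed termwise.
    refine preservesColimitsOfShape_of_evaluation _ _ fun i => ?_
    fin_cases i
    · exact inferInstanceAs (PreservesColimitsOfShape J (torS f 1 ⋙ restrict f))
    · exact inferInstanceAs (PreservesColimitsOfShape J (lowerX f))
    · exact inferInstanceAs (PreservesColimitsOfShape J (𝟭 (ModuleCat.{u} Rᵐᵒᵖ)))
    · exact inferInstanceAs (PreservesColimitsOfShape J (tensorS f ⋙ restrict f))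
    · exact inferInstanceAs (PreservesColimitsOfShape J (upperX f))

variable {f} [(restrict f).Full]

theorem isApproxSeq_of_isFiveTermExact {E : ComposableArrows (ModuleCat.{u} Rᵐᵒᵖ) 4}
    (hE : IsFiveTermExact E) (h₀ : classS f (E.obj 0)) (h₁ : classX f (E.obj 1))
    (h₃ : classS f (E.obj 3)) (h₄ : classX f (E.obj 4)) : IsApproxSeq f E where
  exact := hE
  coreflection := isCoreflection_of_exact hom_eq_zero exists_retraction hE.mono
    (hE.exact.exact' 0 1 2) (hE.exact.exact' 1 2 3) h₀ h₁ h₃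
  reflection := isReflection_of_exact hom_eq_zero exists_retraction hE.epi
    (hE.exact.exact' 1 2 3) (hE.exact.exact' 2 3 4) h₁ h₃ h₄

theorem isCoreflection_lowerXπ (hR : WeakGlobalDimLEOne R)
    (h : TorAcyclic f ((restrict f).obj (ModuleCat.of Sᵐᵒᵖ S))) (M : ModuleCat.{u} Rᵐᵒᵖ) :
    IsCoreflection (classX f) ((lowerXπ f).app M) :=
  (isApproxSeq_of_isFiveTermExact (isFiveTermExact_approxSeq f M)
    ((restrict f).obj_mem_essImage _) (classX_lowerX hR h M) ((restrict f).obj_mem_essImage _)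
    (classX_upperX h M)).coreflection

omit [(restrict f).Full] in
theorem IsApproxSeq.existsUnique_hom {E E' : ComposableArrows (ModuleCat.{u} Rᵐᵒᵖ) 4}
    (hE : IsApproxSeq f E) (hE' : IsApproxSeq f E') (φ : E.obj 2 ⟶ E'.obj 2) :
    ∃! Φ : E ⟶ E', Φ.app 2 = φ :=
  existsUnique_hom_of_isCoreflection_of_isReflection hE.exact hE'.exact hE.coreflection.1
    hE'.coreflection hE.reflection hE'.reflection.1 φ

omit [(restrict f).Full] in
theorem IsApproxSeq.existsUnique_iso {E E' : ComposableArrows (ModuleCat.{u} Rᵐᵒᵖ) 4}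
    (hE : IsApproxSeq f E) (hE' : IsApproxSeq f E') (φ : E.obj 2 ≅ E'.obj 2) :
    ∃! Φ : E ≅ E', Φ.hom.app 2 = φ.hom :=
  existsUnique_iso_of_existsUnique_hom (fun F hF G hG ψ => by
    have hF' : IsApproxSeq f F := by
      rcases hF with rfl | rfl
      exacts [hE, hE']
    have hG' : IsApproxSeq f G := by
      rcases hG with rfl | rfl
      exacts [hE, hE']
    exact hF'.existsUnique_hom hG' ψ) φ

end FiveTerm

end ExtOrtho

end

theorem mainTheorem9 {k : Type w} [CommRing k] {R S : Type u} [Ring R] [Ring S]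
    [Algebra k R] [Algebra k S] (hR : ExtOrtho.WeakGlobalDimLEOne R)
    (f : R →ₐ[k] S) (hf : ExtOrtho.IsHomologicalEpi f) :
    -- existence of the sequence, functorially in `M`
    (∃ (XL XU : ModuleCat.{u} Rᵐᵒᵖ ⥤ ModuleCat.{u} Rᵐᵒᵖ)
      (a : ExtOrtho.torS f.toRingHom 1 ⋙ ExtOrtho.restrict f.toRingHom ⟶ XL)
      (b : XL ⟶ 𝟭 (ModuleCat.{u} Rᵐᵒᵖ))
      (c : ExtOrtho.tensorS f.toRingHom ⋙ ExtOrtho.restrict f.toRingHom ⟶ XU),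
      (∀ M : ModuleCat.{u} Rᵐᵒᵖ,
        ExtOrtho.IsFiveTermExact
          ((ComposableArrows.mk₄ a b (ExtOrtho.unitS f.toRingHom) c).flip.obj M) ∧
        ExtOrtho.IsCoreflection (ExtOrtho.classX f.toRingHom) (b.app M) ∧
        ExtOrtho.IsReflection (ExtOrtho.classS f.toRingHom)
          ((ExtOrtho.unitS f.toRingHom).app M) ∧
        ExtOrtho.classX f.toRingHom (XU.obj M)) ∧
      -- `M ↦ ε_M` commutes with direct limits
      PreservesFilteredColimitsOfSize.{u, u}
        (ComposableArrows.mk₄ a b (ExtOrtho.unitS f.toRingHom) c).flip) ∧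
    -- a five-term exact sequence with terms in `Mod-S`, `𝒳₀`, any, `Mod-S`, `𝒳₀` is such a sequence
    (∀ E : ComposableArrows (ModuleCat.{u} Rᵐᵒᵖ) 4, ExtOrtho.IsFiveTermExact E →
      ExtOrtho.classS f.toRingHom (E.obj 0) → ExtOrtho.classX f.toRingHom (E.obj 1) →
      ExtOrtho.classS f.toRingHom (E.obj 3) → ExtOrtho.classX f.toRingHom (E.obj 4) →
      ExtOrtho.IsApproxSeq f.toRingHom E) ∧
    -- functoriality: a map of middle terms extends uniquely to a map of sequences
    (∀ E E' : ComposableArrows (ModuleCat.{u} Rᵐᵒᵖ) 4,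
      ExtOrtho.IsApproxSeq f.toRingHom E → ExtOrtho.IsApproxSeq f.toRingHom E' →
      ∀ φ : E.obj 2 ⟶ E'.obj 2, ∃! Φ : E ⟶ E', Φ.app 2 = φ) ∧
    -- uniqueness up to a unique isomorphism
    (∀ E E' : ComposableArrows (ModuleCat.{u} Rᵐᵒᵖ) 4,
      ExtOrtho.IsApproxSeq f.toRingHom E → ExtOrtho.IsApproxSeq f.toRingHom E' →
      ∀ φ : E.obj 2 ≅ E'.obj 2, ∃! Φ : E ≅ E', Φ.hom.app 2 = φ.hom) := by
  have := ExtOrtho.restrict_full f hf.1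
  have h := (ExtOrtho.torAcyclic_iff f.toRingHom _).2 (hf.2 1 le_rfl)
  exact ⟨⟨_, _, ExtOrtho.torToLowerX _, ExtOrtho.lowerXπ _, ExtOrtho.upperXπ _,
      fun M => ⟨ExtOrtho.isFiveTermExact_approxSeq _ M, ExtOrtho.isCoreflection_lowerXπ hR h M,
        ExtOrtho.isReflection_unitS _ M, ExtOrtho.classX_upperX h M⟩,
      ExtOrtho.preservesFilteredColimits_approxSeq _⟩,
    fun _ => ExtOrtho.isApproxSeq_of_isFiveTermExact,
    fun _ _ => ExtOrtho.IsApproxSeq.existsUnique_hom,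
    fun _ _ => ExtOrtho.IsApproxSeq.existsUnique_iso⟩
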